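/- **Theorem (NE-to-MFE convergence at rate $O(M^{-1/4})$).** *Energy model.* There are $T$ time slots of length $D_e>0$; $0\le C_{\min}<C_{\max}$ are the battery floor and capacity and $\epsilon>0$. A satellite has an orbital type $\theta$ (in a measurable space $\Theta$), which determines measurably its illumination indicator $\phi_\theta(t)\in\{0,1\}$, its panel angle $\sigma_\theta(t)$ and its baseline power $P^{base}_\theta$; it harvests $P^{harvest}_{\theta,t}=\phi_\theta(t)\,\eta\gamma' A\sin\sigma_\theta(t)$. Operating with battery level $c$ under a population distribution $\mu$ of battery levels, it draws transmit power $\pi_t(\theta,c,\mu)$, where $\pi$ is measurable in $(\theta,c)$ and $$|\pi_t(\theta,c,\mu)-\pi_t(\theta,c',\nu)|\le \ell_c|c-c'|+\ell_\mu W_1(\mu,\nu)$$ for $c,c'\in[0,C_{\max}]$ and probability measures $\mu,\nu$ on $[0,C_{\max}]$. For a flow $\mu=(\mu_t)_t$, the battery state $C(t;\mu)$ of a satellite with initial level $C(0)$ satisfies $C(t+1;\mu)=\min(C(t;\mu)+\Delta E,C_{\max})$ if $\Delta E>0$ and $\max(C(t;\mu)+\Delta E,0)$ otherwise, with $\Delta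 E=D_e\bigl(P^{harvest}_{\theta,t}-\pi_t(\theta,C(t;\mu),\mu_t)-P^{base}_\theta\bigr)$. The pairs $(\theta_m,C_m(0))$, $m=0,1,2,\dots$, are i.i.d. with a law $\rho$ for which $C_m(0)\in[0,C_{\max}]$ almost surely. In the system of the first $M$ satellites each satellite operates under the empirical measure of the current levels, $\mu^M_t=\frac1M\sum_{m}\delta_{C_m(t)}$, so that $C_m(t)=C_m(t;\mu^M)$. The mean-field equilibrium distribution $\mu^*=(\mu^*_t)_t$ is the flow for which $\mu^*_t$ is the law of $C(t;\mu^*)$ when $(\theta,C(0))\sim\rho$. Put $W_1(\mu,\nu)=\max_{t<T}W_1(\mu_t,\nu_t)$ for flows. *Game.* For $M\ge1$ satellites, let $N_m^t$ be the set of satellites to which $m$ has a link in slot $t$, $|N_m^t|\le d_{\max}$. A strategy of $m$ consists of flow rates $Y^{\omega,t}_{m,n}\ge 0$ for finitely many traffic flows $\omega$, which vanish for $n\notin N_m^t$; the link rates are $R^t_{m,n}=\sum_\omega Y^{\omega,t}_{m,n}$, and on links the powers are $P^t_{m,n}(r)=\kappa^t_{m,n}(2^{r/B}-1)$ with $\kappa^t_{m,n}=\frac{k_B\tau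 B}{G_mG_n}\bigl(\frac{4\pi d^t_{m,n}f}{c}\bigr)^2$ (and $\kappa^t_{m,n}=0$ off links). The strategy set $S_m$ is given by $P^t_{m,n}(R^t_{m,n})\le P^{max}_{m,t}$ on all links, where $P^{max}_{m,t}=\min\bigl(\phi_m(t)P^{harvest}_{m,t}+q_m(t)/\delta_m(t),\,P_{\max}\bigr)$ with quasi-static battery readings $q_m(t)\ge0$ and eclipse durations $\delta_m(t)>0$. With multipliers $\lambda^{\omega}(t)\in\mathbb R^M$, the incidence operator $(L_mY_m)_l=\mathbf 1_{l=m}\sum_nY_{m,n}-Y_{m,l}$, and coefficients $0<\lambda_m(t)\le\lambda_{\max}$, the utility of $m$ under a flow $\mu$ is $$U_m(Y;\mu)=\sum_{n,t}R^t_{m,n}-\alpha D_e\sum_{n,t}P^t_{m,n}(R^t_{m,n})-\sum_t\frac{\lambda_m(t)\sum_nP^t_{m,n}(R^t_{m,n})}{C_m(t;\mu)-C_{\min}+\epsilon}-\sum_{\omega,t}\langle\lambda^\omega(t),L_mY^{\omega,t}_m\rangle ,$$ and the potential is $\Phi(Y;\mu)=\sum_mU_m(Y;\mu)$. All scalar parameters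 $\alpha,B,k_B,\tau,f,c,P_{\max},\lambda_{\max}$ are positive; the gains $G_m>0$ are bounded above and the link lengths $d^t_{m,n}$ are bounded below by positive constants that do not depend on $M$. Let $g>0$ be such that, almost surely, $C_m(t)-C_{\min}+\epsilon\ge g$ and $C_m(t;\mu^*)-C_{\min}+\epsilon\ge g$ for all $M$, $m<M$, $t<T$. *Equilibria.* $\mathbf R^{*,M}$ is a Nash equilibrium of the finite-player game with the utilities $U_m(\cdot;\mu^M)$ on $\prod_m S_m$. $R^*_{\mathrm{MFE}}$ is a profile in $\prod_m S_m$ that, for every $m$ and $t$, attains the maximum in the Hamilton–Jacobi–Bellman equation, that is, maximizes the slot-$t$ part of $U_m(\cdot;\mu^*)$ minus $k\,W_1(\delta_{C_m(t;\mu^*)},\mu^*_t)$ (with any weight $k\in\mathbb R$) over the feasible actions of $m$ in slot $t$. *Constants.* Let $K_0=0$, $K_{t+1}=(1+D_e\ell_c)K_t+D_e\ell_\mu$, $$L_U=\frac{\lambda_{\max}\,d_{\max}P_{\max}}{g^2}\sum_{t<T}K_t,\qquad \delta^M=2L_U\,W_1(\mu^M,\mu^*).$$ *Conclusion.* There is a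 constant $C_\mu>0$, depending only on the energy model, on $\rho$ and on $\mu^*$ (not on $M$ or on the games), such that: 1. Almost surely, for every $M\ge1$, every such game and every finite-player equilibrium $\mathbf R^{*,M}$, the profile $\mathbf R^{*,M}$ is a $\delta^M$-Nash equilibrium for the utilities $U_m(\cdot;\mu^*)$ on $\prod_mS_m$. Moreover $\mathbb E[\delta^M]\le 2L_UC_\mu/\sqrt M$ for all $M\ge1$, and $\delta^M\to0$ almost surely. 2. There is $\alpha_\Phi>0$, independent of $M$ and of the game, such that almost surely every potential $\Phi(\cdot;\mu^*)$ is $\alpha_\Phi$-strongly concave in the link rates on $\prod_mS_m$, i.e. $\Phi((1-s)Y+sY')\ge(1-s)\Phi(Y)+s\Phi(Y')+\frac{\alpha_\Phi}{2}s(1-s)\|R-R'\|^2$ for $s\in[0,1]$. Almost surely, for every $M\ge1$, every game and every $\alpha_\Phi>0$ for which this strong concavity holds, and for every $m$, $$\|R^{*,M}_m-R^*_{\mathrm{MFE},m}\|\le\sqrt{\delta^M/\alpha_\Phi},$$ where $\|\cdot\|$ is the Euclidean norm over the link rates $(n,t)$ of satellite $m$; and for every constant $\alpha_\Phi>0$ and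 all $M\ge1$, $$\mathbb E\Bigl[\sqrt{\delta^M/\alpha_\Phi}\Bigr]\le\sqrt{\frac{2L_UC_\mu}{\alpha_\Phi\sqrt M}}=O(M^{-1/4}).$$ -/

import Mathlib

open MeasureTheory ProbabilityTheory Filter Topology Asymptotics

noncomputable section

namespace SatGame

/-! ### Wasserstein distance and measure flows -/

/-- The Wasserstein-1 distance of two probability measures on the line, in its
Kantorovich-Rubinstein form. It is used only for measures carried by a bounded interval. -/
def W1 (μ ν : Measure ℝ) : ℝ :=
  sSup {x : ℝ | ∃ g : ℝ → ℝ, LipschitzWith 1 g ∧ x = |(∫ c, g c ∂μ) - ∫ c, g c ∂ν|}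

/-- Distance of two flows of measures over the slots `0, …, T - 1`: the largest Wasserstein-1
distance of their time marginals. -/
def flowDist (T : ℕ) (μ ν : ℕ → Measure ℝ) : ℝ := ⨆ t : Fin T, W1 (μ t) (ν t)

/-- The empirical measure `(1 / M) ∑ δ_{x m}`. -/
def empMeasure {M : ℕ} (x : Fin M → ℝ) : Measure ℝ :=
  (M : ENNReal)⁻¹ • ∑ m, Measure.dirac (x m)

/-- A probability measure carried by the battery range `[0, Cmax]`. -/
def OnBattery (Cmax : ℝ) (μ : Measure ℝ) : Prop :=
  IsProbabilityMeasure μ ∧ ∀ᵐ c ∂μ, c ∈ Set.Icc 0 Cmax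

/-! ### Energy model -/

/-- The energy model. A satellite has an orbital type `θ : Θ`, which fixes its illumination
indicator, its panel angle and its baseline power. `policy t θ c μ` is the total transmit power
that a satellite of type `θ` with battery level `c` draws in slot `t` when it operates under
the population distribution `μ` of battery levels. -/
structure EnergyModel (Θ : Type*) where
  /-- number of slots -/
  T : ℕ
  /-- slot length -/
  De : ℝ
  /-- battery floor -/
  Cmin : ℝ
  /-- battery capacity -/
  Cmax : ℝ
  /-- regularization of the battery penalty -/
  eps : ℝ
  /-- panel efficiency -/
  eta : ℝ
  /-- solar irradiance -/
  irr : ℝ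
  /-- panel area -/
  area : ℝ
  /-- illumination indicator, `false` in eclipse -/
  illum : Θ → ℕ → Bool
  /-- angle of panel and sunlight -/
  angle : Θ → ℕ → ℝ
  /-- baseline power of the other subsystems -/
  base : Θ → ℝ
  /-- transmit power policy induced by a population distribution -/
  policy : ℕ → Θ → ℝ → Measure ℝ → ℝ
  /-- Lipschitz constant of the policy in the own battery level -/
  ellC : ℝ
  /-- Lipschitz constant of the policy in the population distribution -/
  ellMu : ℝ

namespace EnergyModel

variable {Θ : Type*} (E : EnergyModel Θ)

/-- Solar harvesting power. -/
def harvest (θ : Θ) (t : ℕ) : ℝ :=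
  (if E.illum θ t then 1 else 0) * E.eta * E.irr * E.area * Real.sin (E.angle θ t)

/-- Net energy change in one slot: harvested minus consumed energy. -/
def netEnergy (θ : Θ) (t : ℕ) (c : ℝ) (μ : Measure ℝ) : ℝ :=
  E.De * E.harvest θ t - E.De * (E.policy t θ c μ + E.base θ)

/-- The battery update with saturation at `Cmax` and at `0`. -/
def batteryUpdate (c dE : ℝ) : ℝ :=
  if 0 < dE then min (c + dE) E.Cmax else max (c + dE) 0

/-- One slot of the battery dynamics under the population distribution `μ`. -/
def step (θ : Θ) (t : ℕ) (c : ℝ) (μ : Measure ℝ) : ℝ :=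
  E.batteryUpdate c (E.netEnergy θ t c μ)

/-- The battery level `C(t; μ)` of a satellite of type `z.1` with initial level `z.2` that
operates under the flow of population distributions `μ`. -/
def battery (z : Θ × ℝ) (μ : ℕ → Measure ℝ) : ℕ → ℝ
  | 0 => z.2
  | t + 1 => E.step z.1 t (battery z μ t) (μ t)

/-- The battery levels of the `M` satellites of the finite system: in every slot each satellite
operates under the empirical measure of the current levels. -/
def finiteBattery {M : ℕ} (z : Fin M → Θ × ℝ) : ℕ → Fin M → ℝ
  | 0 => fun m => (z m).2
  | t + 1 => fun m =>
      E.step (z m).1 t (finiteBattery z t m) (empMeasure (finiteBattery z t))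

/-- The flow `μ^M` of empirical battery measures of the finite system. -/
def empFlow {M : ℕ} (z : Fin M → Θ × ℝ) (t : ℕ) : Measure ℝ :=
  empMeasure (E.finiteBattery z t)

/-- The level of satellite `m` in the finite system is its level under the flow `μ^M`. -/
theorem battery_empFlow {M : ℕ} (z : Fin M → Θ × ℝ) (m : Fin M) (t : ℕ) :
    E.battery (z m) (E.empFlow z) t = E.finiteBattery z t m := by
  induction t with
  | zero => rfl
  | succ t ih =>
    change E.step (z m).1 t (E.battery (z m) (E.empFlow z) t) (E.empFlow z t) = _
    rw [ih]; rfl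

/-- The fixed-point property of the mean-field equilibrium distribution: `μ t` is the law of the
level at time `t` of a representative satellite that starts from `ρ` and itself operates under
`μ`; that is, `μ` transports the initial law along the battery dynamics. -/
def IsMeanFieldFlow [MeasurableSpace Θ] (ρ : Measure (Θ × ℝ)) (μ : ℕ → Measure ℝ) : Prop :=
  ∀ t, μ t = ρ.map (fun z => E.battery z μ t)

/-- The level of the representative satellite when it operates under the law of its own level. -/
def mfBattery [MeasurableSpace Θ] (ρ : Measure (Θ × ℝ)) : ℕ → Θ × ℝ → ℝ
  | 0 => fun z => z.2
  | t + 1 => fun z => E.step z.1 t (mfBattery ρ t z) (ρ.map (mfBattery ρ t))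

/-- A mean-field flow exists for every initial law. -/
theorem exists_meanFieldFlow [MeasurableSpace Θ] (ρ : Measure (Θ × ℝ)) :
    ∃ μ, E.IsMeanFieldFlow ρ μ := by
  refine ⟨fun t => ρ.map (E.mfBattery ρ t), fun t => ?_⟩
  have h : ∀ t z, E.battery z (fun t => ρ.map (E.mfBattery ρ t)) t = E.mfBattery ρ t z := by
    intro t z
    induction t with
    | zero => rfl
    | succ t ih =>
      change E.step z.1 t (E.battery z _ t) _ = _
      rw [ih]; rfl
  simp only [h]

/-- Standing assumptions on the energy model. -/
structure Valid [MeasurableSpace Θ] : Prop where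
  De_pos : 0 < E.De
  Cmin_nonneg : 0 ≤ E.Cmin
  Cmin_lt : E.Cmin < E.Cmax
  eps_pos : 0 < E.eps
  meas_illum : ∀ t, Measurable fun θ => E.illum θ t
  meas_angle : ∀ t, Measurable fun θ => E.angle θ t
  meas_base : Measurable E.base
  meas_policy : ∀ t μ, OnBattery E.Cmax μ → Measurable fun z : Θ × ℝ => E.policy t z.1 z.2 μ
  ellC_nonneg : 0 ≤ E.ellC
  ellMu_nonneg : 0 ≤ E.ellMu
  lipschitz : ∀ t θ, ∀ c ∈ Set.Icc 0 E.Cmax, ∀ c' ∈ Set.Icc 0 E.Cmax, ∀ μ ν,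
    OnBattery E.Cmax μ → OnBattery E.Cmax ν →
      |E.policy t θ c μ - E.policy t θ c' ν| ≤ E.ellC * |c - c'| + E.ellMu * W1 μ ν

/-- The constants `K t`, given by `K 0 = 0` and `K (t+1) = (1 + De ellC) K t + De ellMu`, which
measure how strongly `C(t; μ)` reacts to a change of `μ`. -/
def battLip : ℕ → ℝ
  | 0 => 0
  | t + 1 => (1 + E.De * E.ellC) * battLip t + E.De * E.ellMu

/-- The dynamic power ceiling at battery reading `q`, with (remaining or upcoming)
eclipse duration `dur` and static ceiling `Pmax`. -/
def powerCeiling (Pmax : ℝ) (θ : Θ) (t : ℕ) (q dur : ℝ) : ℝ :=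
  if E.illum θ t then min (E.harvest θ t + q / dur) Pmax else min (q / dur) Pmax

end EnergyModel

/-! ### The game -/

/-- Scalar parameters of the game and bounds that hold uniformly over the satellites. -/
structure Params where
  /-- weight of the energy cost -/
  alpha : ℝ
  /-- bandwidth -/
  band : ℝ
  /-- Boltzmann constant -/
  boltz : ℝ
  /-- noise temperature -/
  temp : ℝ
  /-- carrier frequency -/
  freq : ℝ
  /-- speed of light -/
  light : ℝ
  /-- static power ceiling of a link -/
  Pmax : ℝ
  /-- bound of the energy sensitivity coefficients -/
  lamMax : ℝ
  /-- bound of the antenna gains -/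
  gainMax : ℝ
  /-- lower bound of the link lengths -/
  distMin : ℝ
  /-- largest number of links of a satellite -/
  maxDeg : ℕ

/-- Every scalar parameter is positive. -/
structure Params.Valid (p : Params) : Prop where
  alpha_pos : 0 < p.alpha
  band_pos : 0 < p.band
  boltz_pos : 0 < p.boltz
  temp_pos : 0 < p.temp
  freq_pos : 0 < p.freq
  light_pos : 0 < p.light
  Pmax_pos : 0 < p.Pmax
  lamMax_pos : 0 < p.lamMax
  gainMax_pos : 0 < p.gainMax
  distMin_pos : 0 < p.distMin

/-- The data of the penalized game of `M` satellites over `T` slots. -/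
structure Game (T M : ℕ) where
  /-- number of traffic flows -/
  numFlows : ℕ
  /-- the satellites to which `m` has a link in slot `t` -/
  nbr : Fin M → Fin T → Finset (Fin M)
  /-- antenna gains -/
  gain : Fin M → ℝ
  /-- distances -/
  dist : Fin M → Fin M → Fin T → ℝ
  /-- energy sensitivity coefficients -/
  lam : Fin M → Fin T → ℝ
  /-- Lagrange multipliers of flow conservation, for each flow, node and slot -/
  mult : Fin numFlows → Fin M → Fin T → ℝ
  /-- quasi-static battery readings that determine the dynamic power ceilings -/
  reading : Fin M → Fin T → ℝ
  /-- eclipse durations in the dynamic power ceilings -/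
  ecl : Fin M → Fin T → ℝ

namespace Game

variable {T M : ℕ} {Θ : Type*}

/-- The game respects the bounds in `p`. -/
structure Admissible (G : Game T M) (p : Params) : Prop where
  gain_pos : ∀ m, 0 < G.gain m
  gain_le : ∀ m, G.gain m ≤ p.gainMax
  dist_ge : ∀ m t, ∀ n ∈ G.nbr m t, p.distMin ≤ G.dist m n t
  lam_pos : ∀ m t, 0 < G.lam m t
  lam_le : ∀ m t, G.lam m t ≤ p.lamMax
  reading_nonneg : ∀ m t, 0 ≤ G.reading m t
  ecl_pos : ∀ m t, 0 < G.ecl m t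
  card_le : ∀ m t, (G.nbr m t).card ≤ p.maxDeg

/-- The flow rates out of one satellite in one slot: `x w n` is the rate of flow `w` on the link
to `n`. -/
abbrev SlotAction (G : Game T M) : Type := Fin G.numFlows → Fin M → ℝ

/-- A strategy of one satellite: its flow rates in every slot. -/
abbrev Strategy (G : Game T M) : Type := Fin T → G.SlotAction

/-- A strategy profile. -/
abbrev Profile (G : Game T M) : Type := Fin M → G.Strategy

variable (G : Game T M) (p : Params) (E : EnergyModel Θ)

/-- The total data rate on the link to `n`. -/
def rate (x : G.SlotAction) (n : Fin M) : ℝ := ∑ w, x w n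

/-- Adjacency indicator. -/
def adj (m n : Fin M) (t : Fin T) : ℝ := if n ∈ G.nbr m t then 1 else 0

/-- The coefficient `κ` of the power-rate mapping. -/
def kappa (m n : Fin M) (t : Fin T) : ℝ :=
  G.adj m n t * (p.boltz * p.temp * p.band / (G.gain m * G.gain n)) *
    (4 * Real.pi * G.dist m n t * p.freq / p.light) ^ 2

/-- The power needed for the data rate `r` on the link from `m` to `n`. -/
def power (m n : Fin M) (t : Fin T) (r : ℝ) : ℝ :=
  G.kappa p m n t * ((2 : ℝ) ^ (r / p.band) - 1)

/-- The total transmit power of satellite `m` in slot `t`. -/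
def totalPower (m : Fin M) (t : Fin T) (x : G.SlotAction) : ℝ :=
  ∑ n, G.power p m n t (G.rate x n)

/-- Feasible actions of satellite `m`, of type `θ`, in slot `t`: nonnegative flows, only on
existing links, with the power of every link below the dynamic ceiling. -/
def slotSet (θ : Θ) (m : Fin M) (t : Fin T) : Set G.SlotAction :=
  {x | (∀ w n, 0 ≤ x w n) ∧ (∀ w n, n ∉ G.nbr m t → x w n = 0) ∧
    ∀ n, G.power p m n t (G.rate x n) ≤
      G.adj m n t * E.powerCeiling p.Pmax θ t (G.reading m t) (G.ecl m t)}

/-- The strategy set `S_m`. -/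
def strategySet (θ : Θ) (m : Fin M) : Set G.Strategy :=
  {y | ∀ t, y t ∈ G.slotSet p E θ m t}

/-- The contribution `L_m x` of the outgoing flows `x` of satellite `m` to the flow balance
(outflow minus inflow) of node `l`. -/
def balance (m : Fin M) (x : Fin M → ℝ) (l : Fin M) : ℝ :=
  (if l = m then ∑ n, x n else 0) - x l

/-- The payoff of satellite `m` in slot `t` at battery level `c`: throughput, minus energy cost,
minus battery penalty, minus the flow conservation Lagrangian. -/
def slotPayoff (m : Fin M) (t : Fin T) (c : ℝ) (x : G.SlotAction) : ℝ :=
  ∑ n, G.rate x n - p.alpha * E.De * G.totalPower p m t x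
    - G.lam m t * G.totalPower p m t x / (c - E.Cmin + E.eps)
    - ∑ w, ∑ l, G.mult w l t * balance m (x w) l

/-- The penalized utility `U_m(Y; μ)`, where satellite `m` has type and initial battery level
`z m` and the population distributions are `μ`. -/
def utility (z : Fin M → Θ × ℝ) (μ : ℕ → Measure ℝ) (m : Fin M) (Y : G.Profile) : ℝ :=
  ∑ t : Fin T, G.slotPayoff p E m t (E.battery (z m) μ t) (Y m t)

/-- The potential `Φ(Y; μ)`. -/
def potential (z : Fin M → Θ × ℝ) (μ : ℕ → Measure ℝ) (Y : G.Profile) : ℝ :=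
  ∑ m, ∑ t, ∑ n, G.rate (Y m t) n
    - p.alpha * E.De * ∑ m, ∑ t, G.totalPower p m t (Y m t)
    - ∑ m, ∑ t : Fin T, G.lam m t * G.totalPower p m t (Y m t) /
        (E.battery (z m) μ t - E.Cmin + E.eps)
    - ∑ m, ∑ t, ∑ w, ∑ l, G.mult w l t * balance m (Y m t w) l

/-- `Y` is a `δ`-Nash equilibrium of the game in which the population distributions are `μ`. -/
def IsApproxNash (δ : ℝ) (z : Fin M → Θ × ℝ) (μ : ℕ → Measure ℝ) (Y : G.Profile) : Prop :=
  (∀ m, Y m ∈ G.strategySet p E (z m).1 m) ∧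
    ∀ m, ∀ y ∈ G.strategySet p E (z m).1 m,
      G.utility p E z μ m (Function.update Y m y) ≤ G.utility p E z μ m Y + δ

/-- `Y` is a Nash equilibrium of the finite-player penalized game, in which every satellite faces
the empirical battery measures `μ^M`. -/
def IsFiniteNash (z : Fin M → Θ × ℝ) (Y : G.Profile) : Prop :=
  G.IsApproxNash p E 0 z (E.empFlow z) Y

/-- The function maximized in the Hamilton-Jacobi-Bellman equation, at battery level `c` and
population distribution `μ`; `k` weighs the distance of `c` to the population. -/
def hamiltonian (k : ℝ) (m : Fin M) (t : Fin T) (c : ℝ) (μ : Measure ℝ) (x : G.SlotAction) : ℝ :=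
  G.slotPayoff p E m t c x - k * W1 (Measure.dirac c) μ

/-- `Y` is the mean-field equilibrium strategy along the population distributions `μ`: in every
slot each satellite attains the maximum in the Hamilton-Jacobi-Bellman equation. -/
def IsMFEStrategy (k : ℝ) (z : Fin M → Θ × ℝ) (μ : ℕ → Measure ℝ) (Y : G.Profile) : Prop :=
  ∀ (m : Fin M) (t : Fin T), Y m t ∈ G.slotSet p E (z m).1 m t ∧
    ∀ x ∈ G.slotSet p E (z m).1 m t,
      G.hamiltonian p E k m t (E.battery (z m) μ t) (μ t) x ≤
        G.hamiltonian p E k m t (E.battery (z m) μ t) (μ t) (Y m t)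

/-- Squared Euclidean distance of the link rates of two strategies of one satellite. -/
def rateDistSq (y y' : G.Strategy) : ℝ :=
  ∑ t, ∑ n, (G.rate (y t) n - G.rate (y' t) n) ^ 2

/-- The Euclidean distance of the link rates of two strategies of one satellite. -/
def rateDist (y y' : G.Strategy) : ℝ := Real.sqrt (G.rateDistSq y y')

/-- The potential `Φ(·; μ)` is strongly concave with modulus `a` in the link rates, on the product
of the strategy sets. -/
def PotentialStronglyConcave (a : ℝ) (z : Fin M → Θ × ℝ) (μ : ℕ → Measure ℝ) : Prop :=
  ∀ Y Y' : G.Profile, (∀ m, Y m ∈ G.strategySet p E (z m).1 m) →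
    (∀ m, Y' m ∈ G.strategySet p E (z m).1 m) →
    ∀ s ∈ Set.Icc (0 : ℝ) 1,
      (1 - s) * G.potential p E z μ Y + s * G.potential p E z μ Y'
          + (1 - s) * s * (a / 2) * ∑ m, G.rateDistSq (Y m) (Y' m) ≤
        G.potential p E z μ ((1 - s) • Y + s • Y')

end Game

/-- The Lipschitz constant `L_U` of the utility in the population distributions; `g` is the lower
bound of the battery margin. -/
def lipU {Θ : Type*} (E : EnergyModel Θ) (p : Params) (g : ℝ) : ℝ :=
  p.lamMax * (p.maxDeg * p.Pmax) / g ^ 2 * ∑ t ∈ Finset.range E.T, E.battLip t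

/-- `δ^M = 2 L_U W_1(μ^M, μ*)`. -/
def delta {Θ : Type*} (E : EnergyModel Θ) (p : Params) (g : ℝ) {M : ℕ} (z : Fin M → Θ × ℝ)
    (μ : ℕ → Measure ℝ) : ℝ :=
  2 * lipU E p g * flowDist E.T (E.empFlow z) μ

/-- The number `g` is a lower bound of the battery margin `C(t) - Cmin + eps` of all satellites,
under the empirical measures and under `μ`. -/
def MarginBound {Θ : Type*} (E : EnergyModel Θ) (g : ℝ) {M : ℕ} (z : Fin M → Θ × ℝ)
    (μ : ℕ → Measure ℝ) : Prop :=
  ∀ (m : Fin M) (t : Fin E.T), g ≤ E.battery (z m) (E.empFlow z) t - E.Cmin + E.eps ∧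
    g ≤ E.battery (z m) μ t - E.Cmin + E.eps

end SatGame

end

namespace SatGame

/-! ### The Wasserstein distance -/

/-! The proof joins a propagation-of-chaos estimate for the batteries to a deterministic
perturbation argument for the game.

Batteries. Satellites driven by the deterministic flow `μ*` do not interact, and at time `t` their
levels are i.i.d. with law `μ*_t` by the fixed-point property. On the line, `W1` is at most the
integral of the difference of the tails (`W1_le_integral_tail`). At each threshold this difference
is a centred Bernoulli average, of mean size at most `1 / √M`, so integration over `[0, Cmax]` gives
the rate for independent satellites (`integral_W1_sample_le`); the strong law gives almost sure
convergence (`ae_tendsto_W1_sample`). The actual satellites interact through `μ^M`. Coupling each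
with the independent one having the same type and initial level, a discrete Gronwall recursion
bounds the average gap by the earlier sampling errors (`exists_avg_battery_gap_le`). Hence `E
W1(μ^M, μ*) = O(M^{-1/2})`.

Game. The payoff of a satellite involves only its own strategy, and the flow enters only through its
own battery level, in the denominator of the penalty. Levels are Lipschitz in the flow, and bounded
power together with the margin `g` makes payoff differences Lipschitz in the level. So a
finite-player equilibrium loses at most `δ^M / 2` under `μ*` (`payoff_le_of_isFiniteNash`). The
power-rate map is exponential, hence uniformly strongly convex on nonnegative rates, which makes the
potential strongly concave. The mean-field strategy maximizes each payoff, so payoff loss controls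
squared distance (`rateDistSq_le_of_isMFEStrategy`): the strategy gap is at most `√(δ^M / a)`, and
Jensen turns the rate `M^{-1/2}` into `M^{-1/4}`. -/

theorem integrable_of_lipschitz {μ : Measure ℝ} [IsFiniteMeasure μ]
    (hμ : Integrable (fun c => c) μ) {g : ℝ → ℝ} (hg : LipschitzWith 1 g) : Integrable g μ := by
  refine Integrable.mono' (hμ.abs.add (integrable_const |g 0|))
    hg.continuous.measurable.aestronglyMeasurable (ae_of_all _ fun c => ?_)
  have h := hg.dist_le_mul c 0
  simp only [Real.dist_eq, NNReal.coe_one, one_mul, sub_zero] at h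
  have := abs_sub_abs_le_abs_sub (g c) (g 0)
  simp only [Real.norm_eq_abs, Pi.add_apply]
  linarith

theorem abs_integral_sub_integral_le {μ ν : Measure ℝ} [IsProbabilityMeasure μ]
    [IsProbabilityMeasure ν] (hμ : Integrable (fun c => c) μ) (hν : Integrable (fun c => c) ν)
    {g : ℝ → ℝ} (hg : LipschitzWith 1 g) :
    |(∫ c, g c ∂μ) - ∫ c, g c ∂ν| ≤ (∫ c, |c| ∂μ) + ∫ c, |c| ∂ν := by
  have key : ∀ (η : Measure ℝ) [IsProbabilityMeasure η], Integrable (fun c => c) η →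
      |(∫ c, g c ∂η) - g 0| ≤ ∫ c, |c| ∂η := by
    intro η _ hη
    have h1 : (∫ c, g c ∂η) - g 0 = ∫ c, (g c - g 0) ∂η := by
      rw [integral_sub (integrable_of_lipschitz hη hg) (integrable_const _)]
      simp
    rw [h1]
    refine (abs_integral_le_integral_abs).trans (integral_mono
      ((integrable_of_lipschitz hη hg).sub (integrable_const _)).abs hη.abs fun c => ?_)
    have h := hg.dist_le_mul c 0
    simpa [Real.dist_eq] using h
  have h1 := abs_le.1 (key μ hμ)
  have h2 := abs_le.1 (key ν hν)
  rw [abs_le]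
  constructor <;> linarith [h1.1, h1.2, h2.1, h2.2]

/-- Without boundedness the real `sSup` in `W1` would default to `0`; finite first moments make it a
genuine supremum. -/
theorem bddAbove_W1 {μ ν : Measure ℝ} [IsProbabilityMeasure μ]
    [IsProbabilityMeasure ν] (hμ : Integrable (fun c => c) μ) (hν : Integrable (fun c => c) ν) :
    BddAbove {x : ℝ | ∃ g : ℝ → ℝ, LipschitzWith 1 g ∧ x = |(∫ c, g c ∂μ) - ∫ c, g c ∂ν|} := by
  refine ⟨(∫ c, |c| ∂μ) + ∫ c, |c| ∂ν, ?_⟩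
  rintro x ⟨g, hg, rfl⟩
  exact abs_integral_sub_integral_le hμ hν hg

theorem abs_integral_sub_integral_le_W1 {μ ν : Measure ℝ} [IsProbabilityMeasure μ]
    [IsProbabilityMeasure ν] (hμ : Integrable (fun c => c) μ) (hν : Integrable (fun c => c) ν)
    {g : ℝ → ℝ} (hg : LipschitzWith 1 g) :
    |(∫ c, g c ∂μ) - ∫ c, g c ∂ν| ≤ W1 μ ν :=
  le_csSup (bddAbove_W1 hμ hν) ⟨g, hg, rfl⟩

theorem W1_le {μ ν : Measure ℝ} {a : ℝ}
    (h : ∀ g : ℝ → ℝ, LipschitzWith 1 g → |(∫ c, g c ∂μ) - ∫ c, g c ∂ν| ≤ a) : W1 μ ν ≤ a := by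
  refine csSup_le ⟨_, fun _ => 0, LipschitzWith.const' 0, rfl⟩ ?_
  rintro x ⟨g, hg, rfl⟩
  exact h g hg

theorem W1_nonneg (μ ν : Measure ℝ) : 0 ≤ W1 μ ν := by
  refine Real.sSup_nonneg ?_
  rintro x ⟨g, -, rfl⟩
  exact abs_nonneg _

theorem W1_comm (μ ν : Measure ℝ) : W1 μ ν = W1 ν μ := by
  simp only [W1, abs_sub_comm]

theorem W1_triangle {μ ν η : Measure ℝ} [IsProbabilityMeasure μ] [IsProbabilityMeasure ν]
    [IsProbabilityMeasure η] (hμ : Integrable (fun c => c) μ) (hν : Integrable (fun c => c) ν)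
    (hη : Integrable (fun c => c) η) : W1 μ η ≤ W1 μ ν + W1 ν η :=
  W1_le fun _ hg => (abs_sub_le _ _ _).trans (add_le_add
    (abs_integral_sub_integral_le_W1 hμ hν hg) (abs_integral_sub_integral_le_W1 hν hη hg))

theorem OnBattery.integrable {R : ℝ} {μ : Measure ℝ} (h : OnBattery R μ) :
    Integrable (fun c => c) μ := by
  have := h.1
  refine Integrable.of_bound measurable_id.aestronglyMeasurable |R| ?_
  filter_upwards [h.2] with c hc
  simp only [Real.norm_eq_abs]
  exact abs_le_abs_of_nonneg hc.1 hc.2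

/-! ### Empirical measures -/

theorem isProbabilityMeasure_empMeasure {M : ℕ} (hM : M ≠ 0) (x : Fin M → ℝ) :
    IsProbabilityMeasure (empMeasure x) := by
  constructor
  simp only [empMeasure, Measure.smul_apply, Measure.finsetSum_apply, measure_univ,
    Finset.sum_const, Finset.card_univ, Fintype.card_fin, nsmul_eq_mul, mul_one, smul_eq_mul]
  exact ENNReal.inv_mul_cancel (by exact_mod_cast hM) (by simp)

theorem integrable_empMeasure {M : ℕ} (hM : M ≠ 0) (x : Fin M → ℝ) (g : ℝ → ℝ) :
    Integrable g (empMeasure x) := by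
  refine Integrable.smul_measure ?_ (by simpa using hM)
  exact integrable_finsetSum_measure.2 fun i _ => integrable_dirac (by simp)

theorem integral_empMeasure {M : ℕ} (x : Fin M → ℝ) (g : ℝ → ℝ) :
    ∫ c, g c ∂(empMeasure x) = (M : ℝ)⁻¹ * ∑ m, g (x m) := by
  rw [empMeasure, integral_smul_measure, integral_finsetSum_measure]
  · simp
  · exact fun i _ => integrable_dirac (by simp)

theorem onBattery_empMeasure {M : ℕ} (hM : M ≠ 0) {R : ℝ} {x : Fin M → ℝ}
    (hx : ∀ m, x m ∈ Set.Icc 0 R) : OnBattery R (empMeasure x) := by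
  refine ⟨isProbabilityMeasure_empMeasure hM x, ?_⟩
  refine Measure.ae_smul_measure ?_ _
  rw [ae_iff, Measure.finsetSum_apply]
  refine Finset.sum_eq_zero fun m _ => ?_
  rw [← ae_iff, ae_dirac_eq]
  exact hx m

theorem W1_empMeasure_empMeasure_le {M : ℕ} (x y : Fin M → ℝ) :
    W1 (empMeasure x) (empMeasure y) ≤ (M : ℝ)⁻¹ * ∑ m, |x m - y m| := by
  refine W1_le fun g hg => ?_
  rw [integral_empMeasure, integral_empMeasure, ← mul_sub, ← Finset.sum_sub_distrib, abs_mul,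
    abs_of_nonneg (by positivity : 0 ≤ (M : ℝ)⁻¹)]
  refine mul_le_mul_of_nonneg_left ((Finset.abs_sum_le_sum_abs _ _).trans
    (Finset.sum_le_sum fun m _ => ?_)) (by positivity)
  simpa [Real.dist_eq] using hg.dist_le_mul (x m) (y m)

/-- The distance to a fixed measure is a continuous function of the atoms. -/
theorem continuous_W1_empMeasure {M : ℕ} (hM : M ≠ 0) {ν : Measure ℝ} [IsProbabilityMeasure ν]
    (hν : Integrable (fun c => c) ν) :
    Continuous fun x : Fin M → ℝ => W1 (empMeasure x) ν := by
  rw [continuous_iff_continuousAt]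
  intro x
  have hp := isProbabilityMeasure_empMeasure hM
  have h0 : Tendsto (fun y : Fin M → ℝ => (M : ℝ)⁻¹ * ∑ m, |y m - x m|) (𝓝 x) (𝓝 0) := by
    have : Continuous (fun y : Fin M → ℝ => (M : ℝ)⁻¹ * ∑ m, |y m - x m|) := by fun_prop
    simpa using this.tendsto x
  rw [ContinuousAt, tendsto_iff_norm_sub_tendsto_zero]
  refine squeeze_zero (fun _ => norm_nonneg _) (fun y => ?_) h0
  have := hp x
  have := hp y
  have h1 := W1_triangle (integrable_empMeasure hM x _) (integrable_empMeasure hM y _) hν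
  have h2 := W1_triangle (integrable_empMeasure hM y _) (integrable_empMeasure hM x _) hν
  have h3 := W1_empMeasure_empMeasure_le y x
  rw [W1_comm (empMeasure x) (empMeasure y)] at h1
  rw [Real.norm_eq_abs, abs_le]
  constructor <;> linarith

/-! ### Comparison with the distance of the tails -/

/-- A Lipschitz function is absolutely continuous, so `g c - g 0` is the integral of `deriv g` over
`(0, c)`; Fubini then exchanges `c` and `x`. -/
theorem integral_lipschitz_eq {R : ℝ} {μ : Measure ℝ} (h : OnBattery R μ)
    {g : ℝ → ℝ} (hg : LipschitzWith 1 g) :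
    ∫ c, g c ∂μ = g 0 + ∫ x in Set.Ioc 0 R, μ.real (Set.Ioi x) * deriv g x := by
  have := h.1
  have hd : ∀ x, |deriv g x| ≤ 1 := fun x => by
    simpa using norm_deriv_le_of_lipschitz (x₀ := x) hg
  have hgi := integrable_of_lipschitz h.integrable hg
  have hc : ∀ᵐ c ∂μ, g c - g 0 =
      ∫ x in Set.Ioc 0 R, (Set.Iio c).indicator (deriv g) x := by
    filter_upwards [h.2] with c hc
    have hac : AbsolutelyContinuousOnInterval g 0 c :=
      hg.lipschitzOnWith.absolutelyContinuousOnInterval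
    rw [← hac.integral_deriv_eq_sub, intervalIntegral.integral_of_le hc.1,
      setIntegral_indicator measurableSet_Iio]
    refine (setIntegral_congr_set (Ioo_ae_eq_Ioc)).symm.trans ?_
    refine (setIntegral_congr_set ?_)
    refine (ae_of_all _ fun x => ?_)
    refine propext ⟨fun hx => ?_, fun hx => ?_⟩
    · exact ⟨⟨hx.1, hx.2.le.trans hc.2⟩, hx.2⟩
    · exact ⟨hx.1.1, hx.2⟩
  have h1 : (∫ c, g c ∂μ) - g 0 = ∫ c, (g c - g 0) ∂μ := by
    rw [integral_sub hgi (integrable_const _)]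
    simp
  rw [← sub_eq_iff_eq_add', h1, integral_congr_ae hc, integral_integral_swap]
  · refine integral_congr_ae (ae_of_all _ fun x => ?_)
    -- As a function of `c`, the condition `x < c` cuts out `Ioi x`, whose mass is the tail.
    have : ∀ c, (Set.Iio c).indicator (deriv g) x =
        (Set.Ioi x).indicator (fun _ => deriv g x) c := by
      intro c
      simp [Set.indicator]
    simp only [this]
    rw [integral_indicator measurableSet_Ioi]
    simp
  · have hm : MeasurableSet {p : ℝ × ℝ | p.2 < p.1} :=
      measurableSet_lt measurable_snd measurable_fst
    have heq : (Function.uncurry fun c x => (Set.Iio c).indicator (deriv g) x) =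
        {p : ℝ × ℝ | p.2 < p.1}.indicator fun p => deriv g p.2 := by
      ext ⟨c, x⟩
      simp [Set.indicator]
    rw [heq]
    refine Integrable.of_bound (((measurable_deriv g).comp measurable_snd).indicator
      hm).aestronglyMeasurable 1 (ae_of_all _ fun p => ?_)
    rw [Set.indicator]
    split_ifs
    · exact hd _
    · simp

theorem integrableOn_tail (R : ℝ) (μ : Measure ℝ) [IsProbabilityMeasure μ] :
    IntegrableOn (fun x => μ.real (Set.Ioi x)) (Set.Ioc 0 R) := by
  have hm : Measurable fun x => μ.real (Set.Ioi x) :=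
    Antitone.measurable fun x y hxy => measureReal_mono (Set.Ioi_subset_Ioi hxy)
  refine Integrable.of_bound hm.aestronglyMeasurable 1 (ae_of_all _ fun x => ?_)
  rw [Real.norm_eq_abs, abs_of_nonneg measureReal_nonneg]
  exact measureReal_le_one

/-- The bound is uniform over the test functions because `|deriv g| ≤ 1`. It replaces a supremum
over functions by an integral over thresholds, which commutes with expectation. -/
theorem W1_le_integral_tail {R : ℝ} {μ ν : Measure ℝ} (hμ : OnBattery R μ) (hν : OnBattery R ν) :
    W1 μ ν ≤ ∫ x in Set.Ioc 0 R, |μ.real (Set.Ioi x) - ν.real (Set.Ioi x)| := by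
  have := hμ.1
  have := hν.1
  refine W1_le fun g hg => ?_
  have hd : ∀ x, |deriv g x| ≤ 1 := fun x => by
    simpa using norm_deriv_le_of_lipschitz (x₀ := x) hg
  have hi : ∀ (η : Measure ℝ) [IsProbabilityMeasure η],
      IntegrableOn (fun x => η.real (Set.Ioi x) * deriv g x) (Set.Ioc 0 R) := fun η _ =>
    (integrableOn_tail R η).mul_bdd (c := 1) (measurable_deriv g).aestronglyMeasurable
      (ae_of_all _ fun x => hd x)
  rw [integral_lipschitz_eq hμ hg, integral_lipschitz_eq hν hg, add_sub_add_left_eq_sub,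
    ← integral_sub (hi μ) (hi ν)]
  refine abs_integral_le_integral_abs.trans (integral_mono ((hi μ).sub (hi ν)).abs
    ((integrableOn_tail R μ).sub (integrableOn_tail R ν)).abs fun x => ?_)
  dsimp only
  rw [← sub_mul, abs_mul]
  exact mul_le_of_le_one_right (abs_nonneg _) (hd x)

theorem tail_empMeasure {M : ℕ} (x : Fin M → ℝ) (a : ℝ) :
    (empMeasure x).real (Set.Ioi a) =
      (M : ℝ)⁻¹ * ∑ m, (Set.Ioi a).indicator (fun _ => 1) (x m) := by
  rw [← integral_empMeasure, integral_indicator measurableSet_Ioi]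
  simp

/-! ### Battery dynamics -/

theorem W1_le_flowDist {T : ℕ} (μ ν : ℕ → Measure ℝ) {t : ℕ} (ht : t < T) :
    W1 (μ t) (ν t) ≤ flowDist T μ ν :=
  le_ciSup (f := fun t : Fin T => W1 (μ t) (ν t)) (Set.finite_range _).bddAbove ⟨t, ht⟩

theorem flowDist_nonneg (T : ℕ) (μ ν : ℕ → Measure ℝ) : 0 ≤ flowDist T μ ν :=
  Real.iSup_nonneg fun _ => W1_nonneg _ _

theorem flowDist_le {T : ℕ} {μ ν : ℕ → Measure ℝ} {a : ℝ} (ha : 0 ≤ a)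
    (h : ∀ t < T, W1 (μ t) (ν t) ≤ a) : flowDist T μ ν ≤ a :=
  Real.iSup_le (fun t => h t t.2) ha

namespace EnergyModel

variable {Θ : Type*} {E : EnergyModel Θ}

/-- For `c` in the battery range, the saturation omitted in each case is inactive. The resulting
clamp is `1`-Lipschitz, which the case distinction hides. -/
theorem batteryUpdate_eq {c : ℝ} (hc : c ∈ Set.Icc 0 E.Cmax) (d : ℝ) :
    E.batteryUpdate c d = max (min (c + d) E.Cmax) 0 := by
  unfold batteryUpdate
  split_ifs with h
  · exact (max_eq_left (le_min (by linarith [hc.1]) (hc.1.trans hc.2))).symm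
  · rw [min_eq_left (by linarith [hc.2])]

theorem step_mem {c : ℝ} (hc : c ∈ Set.Icc 0 E.Cmax) (θ : Θ) (t : ℕ) (μ : Measure ℝ) :
    E.step θ t c μ ∈ Set.Icc 0 E.Cmax := by
  rw [step, batteryUpdate_eq hc]
  exact ⟨le_max_right _ _, max_le (min_le_right _ _) (hc.1.trans hc.2)⟩

theorem battery_succ (z : Θ × ℝ) (μ : ℕ → Measure ℝ) (t : ℕ) :
    E.battery z μ (t + 1) = E.step z.1 t (E.battery z μ t) (μ t) := rfl

theorem finiteBattery_succ {M : ℕ} (z : Fin M → Θ × ℝ) (t : ℕ) (m : Fin M) :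
    E.finiteBattery z (t + 1) m =
      E.step (z m).1 t (E.finiteBattery z t m) (E.empFlow z t) := rfl

theorem battery_mem {z : Θ × ℝ} (hz : z.2 ∈ Set.Icc 0 E.Cmax) (μ : ℕ → Measure ℝ) (t : ℕ) :
    E.battery z μ t ∈ Set.Icc 0 E.Cmax := by
  induction t with
  | zero => exact hz
  | succ t ih => exact step_mem ih _ _ _

theorem finiteBattery_mem {M : ℕ} {z : Fin M → Θ × ℝ} (hz : ∀ m, (z m).2 ∈ Set.Icc 0 E.Cmax)
    (t : ℕ) (m : Fin M) : E.finiteBattery z t m ∈ Set.Icc 0 E.Cmax := by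
  rw [← battery_empFlow]
  exact battery_mem (hz m) _ _

theorem onBattery_empFlow {M : ℕ} (hM : M ≠ 0) {z : Fin M → Θ × ℝ}
    (hz : ∀ m, (z m).2 ∈ Set.Icc 0 E.Cmax) (t : ℕ) : OnBattery E.Cmax (E.empFlow z t) :=
  onBattery_empMeasure hM (finiteBattery_mem hz t)

theorem abs_step_sub_step_le [MeasurableSpace Θ] (hE : E.Valid) (θ : Θ) (t : ℕ) {c c' : ℝ}
    (hc : c ∈ Set.Icc 0 E.Cmax) (hc' : c' ∈ Set.Icc 0 E.Cmax) {μ ν : Measure ℝ}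
    (hμ : OnBattery E.Cmax μ) (hν : OnBattery E.Cmax ν) :
    |E.step θ t c μ - E.step θ t c' ν| ≤
      (1 + E.De * E.ellC) * |c - c'| + E.De * E.ellMu * W1 μ ν := by
  rw [step, step, batteryUpdate_eq hc, batteryUpdate_eq hc']
  refine (abs_max_sub_max_le_abs _ _ _).trans ?_
  refine ((abs_min_sub_min_le_max _ _ _ _).trans_eq ?_).trans
    (?_ : |(c + E.netEnergy θ t c μ) - (c' + E.netEnergy θ t c' ν)| ≤ _)
  · simp
  · have h1 := hE.lipschitz t θ c hc c' hc' μ ν hμ hν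
    have h2 : (c + E.netEnergy θ t c μ) - (c' + E.netEnergy θ t c' ν) =
        (c - c') + -(E.De * (E.policy t θ c μ - E.policy t θ c' ν)) := by
      unfold netEnergy; ring
    rw [h2]
    refine (abs_add_le _ _).trans ?_
    rw [abs_neg, abs_mul, abs_of_pos hE.De_pos]
    nlinarith [mul_le_mul_of_nonneg_left h1 hE.De_pos.le]

theorem battLip_nonneg [MeasurableSpace Θ] (hE : E.Valid) (t : ℕ) : 0 ≤ E.battLip t := by
  have h1 := hE.De_pos
  have h2 := hE.ellC_nonneg
  have h3 := hE.ellMu_nonneg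
  induction t with
  | zero => exact le_rfl
  | succ t ih => simp only [battLip]; positivity

/-- The level `C(t; μ)` is Lipschitz in the flow `μ`, with constant `battLip t`. -/
theorem abs_battery_sub_battery_le [MeasurableSpace Θ] (hE : E.Valid) {z : Θ × ℝ}
    (hz : z.2 ∈ Set.Icc 0 E.Cmax) {μ ν : ℕ → Measure ℝ} (hμ : ∀ t, OnBattery E.Cmax (μ t))
    (hν : ∀ t, OnBattery E.Cmax (ν t)) {T t : ℕ} (ht : t ≤ T) :
    |E.battery z μ t - E.battery z ν t| ≤ E.battLip t * flowDist T μ ν := by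
  induction t with
  | zero => simp [battery, battLip]
  | succ t ih =>
    have h1 := hE.De_pos
    have h2 := hE.ellC_nonneg
    have h3 := hE.ellMu_nonneg
    refine (abs_step_sub_step_le hE z.1 t (battery_mem hz μ t) (battery_mem hz ν t) (hμ t)
      (hν t)).trans ?_
    have h4 := mul_le_mul_of_nonneg_left (ih (by omega)) (by positivity : 0 ≤ 1 + E.De * E.ellC)
    have h5 := mul_le_mul_of_nonneg_left (W1_le_flowDist μ ν (by omega : t < T))
      (by positivity : 0 ≤ E.De * E.ellMu)
    simp only [battLip]
    linarith

/-- The average gap between the finite system and independent satellites that operate under `ν`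
is controlled by the sampling errors of the independent satellites. -/
theorem exists_avg_battery_gap_le [MeasurableSpace Θ] (hE : E.Valid) (t : ℕ) :
    ∃ L : ℝ, 0 ≤ L ∧ ∀ (M : ℕ) (z : Fin M → Θ × ℝ) (ν : ℕ → Measure ℝ), M ≠ 0 →
      (∀ m, (z m).2 ∈ Set.Icc 0 E.Cmax) → (∀ s, OnBattery E.Cmax (ν s)) →
      (M : ℝ)⁻¹ * ∑ m, |E.finiteBattery z t m - E.battery (z m) ν t| ≤
        L * ∑ s ∈ Finset.range t, W1 (empMeasure fun m => E.battery (z m) ν s) (ν s) := by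
  have h1 := hE.De_pos
  have h2 := hE.ellC_nonneg
  have h3 := hE.ellMu_nonneg
  induction t with
  | zero => exact ⟨0, le_rfl, fun M z ν _ _ _ => by simp [finiteBattery, battery]⟩
  | succ t ih =>
    obtain ⟨L, hL, ih⟩ := ih
    -- Averaging one step turns the gap `a` into at most `(1 + De ellC + De ellMu) a + De ellMu w`,
    -- with `w` the new sampling error; `a ≤ L S` then gives this constant.
    refine ⟨(1 + E.De * E.ellC + E.De * E.ellMu) * L + E.De * E.ellMu, by positivity, ?_⟩
    intro M z ν hM hz hν
    have hMpos : (0 : ℝ) < M := by exact_mod_cast Nat.pos_of_ne_zero hM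
    have ih := ih M z ν hM hz hν
    set a := (M : ℝ)⁻¹ * ∑ m, |E.finiteBattery z t m - E.battery (z m) ν t| with ha
    set w := W1 (empMeasure fun m => E.battery (z m) ν t) (ν t)
    set S := ∑ s ∈ Finset.range t, W1 (empMeasure fun m => E.battery (z m) ν s) (ν s)
    have hS : 0 ≤ S := Finset.sum_nonneg fun _ _ => W1_nonneg _ _
    have hw : 0 ≤ w := W1_nonneg _ _
    have hemp := onBattery_empFlow hM hz t
    have hp1 := hemp.1
    have hp2 := isProbabilityMeasure_empMeasure hM fun m => E.battery (z m) ν t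
    have hp3 := (hν t).1
    -- The triangle inequality passes through the empirical measure of the independent satellites:
    -- pairing equal indices costs `a`, sampling costs `w`.
    have hW : W1 (E.empFlow z t) (ν t) ≤ a + w :=
      (W1_triangle hemp.integrable (integrable_empMeasure hM _ _) (hν t).integrable).trans
        (add_le_add (W1_empMeasure_empMeasure_le _ _) le_rfl)
    have hm : ∀ m, |E.finiteBattery z (t + 1) m - E.battery (z m) ν (t + 1)| ≤
        (1 + E.De * E.ellC) * |E.finiteBattery z t m - E.battery (z m) ν t| +
          E.De * E.ellMu * (a + w) := fun m => by
      have h4 := abs_step_sub_step_le hE (z m).1 t (finiteBattery_mem hz t m)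
        (battery_mem (hz m) ν t) hemp (hν t)
      have h5 := mul_le_mul_of_nonneg_left hW (by positivity : 0 ≤ E.De * E.ellMu)
      rw [finiteBattery_succ, battery_succ]
      linarith
    calc (M : ℝ)⁻¹ * ∑ m, |E.finiteBattery z (t + 1) m - E.battery (z m) ν (t + 1)|
        ≤ (M : ℝ)⁻¹ * ∑ m, ((1 + E.De * E.ellC) * |E.finiteBattery z t m - E.battery (z m) ν t| +
          E.De * E.ellMu * (a + w)) := by gcongr with m; exact hm m
      _ = (1 + E.De * E.ellC + E.De * E.ellMu) * a + E.De * E.ellMu * w := by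
          rw [Finset.sum_add_distrib, ← Finset.mul_sum, ha]
          simp only [Finset.sum_const, Finset.card_univ, Fintype.card_fin, nsmul_eq_mul]
          field_simp
          ring
      _ ≤ (1 + E.De * E.ellC + E.De * E.ellMu) * (L * S) + E.De * E.ellMu * w := by gcongr
      _ ≤ _ := by
          rw [Finset.sum_range_succ]
          change _ ≤ _ * (S + w)
          clear_value S w
          have e1 : 0 ≤ (1 + E.De * E.ellC + E.De * E.ellMu) * L * w := by positivity
          have e2 : 0 ≤ E.De * E.ellMu * S := by positivity
          linarith

theorem exists_flowDist_empFlow_le [MeasurableSpace Θ] (hE : E.Valid) :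
    ∃ A : ℝ, 0 ≤ A ∧ ∀ (M : ℕ) (z : Fin M → Θ × ℝ) (ν : ℕ → Measure ℝ), M ≠ 0 →
      (∀ m, (z m).2 ∈ Set.Icc 0 E.Cmax) → (∀ s, OnBattery E.Cmax (ν s)) →
      flowDist E.T (E.empFlow z) ν ≤
        A * ∑ s ∈ Finset.range E.T, W1 (empMeasure fun m => E.battery (z m) ν s) (ν s) := by
  choose L hL h using exists_avg_battery_gap_le hE
  -- The sum stands in for the maximum of `L t + 1` over the slots.
  have hA : 0 ≤ ∑ t ∈ Finset.range E.T, (L t + 1) :=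
    Finset.sum_nonneg fun t _ => by linarith [hL t]
  refine ⟨∑ t ∈ Finset.range E.T, (L t + 1), hA, fun M z ν hM hz hν => ?_⟩
  set w := fun s => W1 (empMeasure fun m => E.battery (z m) ν s) (ν s)
  have hw : ∀ s, 0 ≤ w s := fun s => W1_nonneg _ _
  have hS : 0 ≤ ∑ s ∈ Finset.range E.T, w s := Finset.sum_nonneg fun s _ => hw s
  refine flowDist_le (mul_nonneg hA hS) fun t ht => ?_
  have hemp := onBattery_empFlow hM hz t
  have hp1 := hemp.1
  have hp2 := isProbabilityMeasure_empMeasure hM fun m => E.battery (z m) ν t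
  have hp3 := (hν t).1
  have h1 : W1 (E.empFlow z t) (ν t) ≤ L t * (∑ s ∈ Finset.range t, w s) + w t :=
    (W1_triangle hemp.integrable (integrable_empMeasure hM _ _) (hν t).integrable).trans
      (add_le_add ((W1_empMeasure_empMeasure_le _ _).trans (h t M z ν hM hz hν)) le_rfl)
  have h2 : ∑ s ∈ Finset.range t, w s ≤ ∑ s ∈ Finset.range E.T, w s :=
    Finset.sum_le_sum_of_subset_of_nonneg (Finset.range_subset_range.2 ht.le) fun s _ _ => hw s
  have h3 : w t ≤ ∑ s ∈ Finset.range E.T, w s :=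
    Finset.single_le_sum (fun s _ => hw s) (Finset.mem_range.2 ht)
  have h4 : L t + 1 ≤ ∑ t ∈ Finset.range E.T, (L t + 1) :=
    Finset.single_le_sum (f := fun t => L t + 1) (fun s _ => by linarith [hL s])
      (Finset.mem_range.2 ht)
  calc W1 (E.empFlow z t) (ν t) ≤ L t * (∑ s ∈ Finset.range t, w s) + w t := h1
    _ ≤ L t * (∑ s ∈ Finset.range E.T, w s) + ∑ s ∈ Finset.range E.T, w s := by
        have := hL t
        gcongr
    _ = (L t + 1) * ∑ s ∈ Finset.range E.T, w s := by ring
    _ ≤ _ := by gcongr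

/-! ### Measurability -/

variable [MeasurableSpace Θ]

theorem measurable_harvest (hE : E.Valid) (t : ℕ) : Measurable fun θ => E.harvest θ t := by
  have h1 := hE.meas_angle t
  have h2 : Measurable fun θ => (if E.illum θ t then (1 : ℝ) else 0) :=
    Measurable.ite (hE.meas_illum t (measurableSet_singleton true)) measurable_const
      measurable_const
  unfold harvest
  fun_prop

theorem measurable_step (hE : E.Valid) (t : ℕ) {μ : Measure ℝ} (hμ : OnBattery E.Cmax μ) :
    Measurable fun z : Θ × ℝ => E.step z.1 t z.2 μ := by
  have h1 := hE.meas_policy t μ hμ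
  have h2 : Measurable fun z : Θ × ℝ => E.harvest z.1 t :=
    (measurable_harvest hE t).comp measurable_fst
  have h3 : Measurable fun z : Θ × ℝ => E.base z.1 := hE.meas_base.comp measurable_fst
  have h4 : Measurable fun z : Θ × ℝ => E.netEnergy z.1 t z.2 μ := by
    unfold netEnergy
    exact (h2.const_mul _).sub ((h1.add h3).const_mul _)
  unfold step batteryUpdate
  exact Measurable.ite (measurableSet_lt measurable_const h4)
    ((measurable_snd.add h4).min measurable_const) ((measurable_snd.add h4).max measurable_const)

theorem measurable_step_left (hE : E.Valid) (t : ℕ) {μ : Measure ℝ} (hμ : OnBattery E.Cmax μ)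
    (c : ℝ) : Measurable fun θ : Θ => E.step θ t c μ := by
  have h := (measurable_step hE t hμ).comp (measurable_prodMk_right (y := c))
  simpa only [Function.comp_def] using h

/-- The two claims need a joint induction: the policy is measurable only for measures on the battery
range, and `μ t` is known to be one only once the level at `t` is measurable. -/
theorem IsMeanFieldFlow.onBattery_and_measurable (hE : E.Valid) {ρ : Measure (Θ × ℝ)}
    [IsProbabilityMeasure ρ] (hρ : ∀ᵐ z ∂ρ, z.2 ∈ Set.Icc 0 E.Cmax) {μ : ℕ → Measure ℝ}
    (hμ : E.IsMeanFieldFlow ρ μ) (t : ℕ) :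
    OnBattery E.Cmax (μ t) ∧ Measurable fun z => E.battery z μ t := by
  have aux : ∀ t, Measurable (fun z => E.battery z μ t) → OnBattery E.Cmax (μ t) := by
    intro t ht
    rw [hμ t]
    refine ⟨Measure.isProbabilityMeasure_map ht.aemeasurable, ?_⟩
    refine (ae_map_iff ht.aemeasurable (measurableSet_Icc (a := 0) (b := E.Cmax))).2 ?_
    filter_upwards [hρ] with z hz using battery_mem hz μ t
  induction t with
  | zero => exact ⟨aux 0 measurable_snd, measurable_snd⟩
  | succ t ih =>
    have : Measurable fun z => E.battery z μ (t + 1) :=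
      (measurable_step hE t ih.1).comp (measurable_fst.prodMk ih.2)
    exact ⟨aux _ this, this⟩

/-- One step of the finite system is jointly measurable in the type and the levels, once the
levels are truncated to the battery range. -/
theorem measurable_step_empMeasure (hE : E.Valid) (t : ℕ) {M : ℕ} (hM : M ≠ 0) (m : Fin M) :
    Measurable fun q : (Fin M → ℝ) × Θ =>
      E.step q.2 t (Set.projIcc 0 E.Cmax (hE.Cmin_nonneg.trans hE.Cmin_lt.le) (q.1 m))
        (empMeasure fun n =>
          (Set.projIcc 0 E.Cmax (hE.Cmin_nonneg.trans hE.Cmin_lt.le) (q.1 n) : ℝ)) := by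
  have h0 := hE.Cmin_nonneg.trans hE.Cmin_lt.le
  set π : ℝ → ℝ := fun c => Set.projIcc 0 E.Cmax h0 c with hπ
  have hπm : ∀ c, π c ∈ Set.Icc 0 E.Cmax := fun c => (Set.projIcc 0 E.Cmax h0 c).2
  have hπc : Continuous π := continuous_subtype_val.comp continuous_projIcc
  -- A Carathéodory function: continuous in the levels, measurable in the type. Truncation by `π`
  -- makes the Lipschitz hypothesis available at every level.
  refine measurable_uncurry_of_continuous_of_measurable
    (u := fun (x : Fin M → ℝ) θ => E.step θ t (π (x m)) (empMeasure fun n => π (x n)))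
    (fun θ => ?_) fun x => ?_
  · rw [continuous_iff_continuousAt]
    intro x
    have hc : Continuous fun y : Fin M → ℝ => (1 + E.De * E.ellC) * |π (y m) - π (x m)| +
        E.De * E.ellMu * ((M : ℝ)⁻¹ * ∑ n, |π (y n) - π (x n)|) := by fun_prop
    rw [ContinuousAt, tendsto_iff_norm_sub_tendsto_zero]
    refine squeeze_zero (fun _ => norm_nonneg _) (fun y => ?_) (by simpa using hc.tendsto x)
    have h1 := hE.De_pos
    have h3 := hE.ellMu_nonneg
    have h4 := abs_step_sub_step_le hE θ t (hπm (y m)) (hπm (x m))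
      (onBattery_empMeasure hM fun n => hπm (y n))
      (onBattery_empMeasure hM fun n => hπm (x n))
    have h5 := mul_le_mul_of_nonneg_left
      (W1_empMeasure_empMeasure_le (fun n => π (y n)) (fun n => π (x n)))
      (by positivity : 0 ≤ E.De * E.ellMu)
    rw [Real.norm_eq_abs]
    linarith
  · exact measurable_step_left hE t (onBattery_empMeasure hM fun n => hπm (x n)) (π (x m))

/-- Only almost everywhere measurability is obtained, because the initial levels lie in the battery
range only almost surely; there the truncated step is the true one. -/
theorem aemeasurable_finiteBattery (hE : E.Valid) {Ω : Type*} [MeasurableSpace Ω]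
    {P : Measure Ω} {M : ℕ} (hM : M ≠ 0) {z : Ω → Fin M → Θ × ℝ} (hz : Measurable z)
    (hr : ∀ᵐ ω ∂P, ∀ m, (z ω m).2 ∈ Set.Icc 0 E.Cmax) (t : ℕ) :
    AEMeasurable (fun ω => E.finiteBattery (z ω) t) P := by
  induction t with
  | zero =>
    refine Measurable.aemeasurable (measurable_pi_lambda _ fun m => ?_)
    exact measurable_snd.comp ((measurable_pi_apply m).comp hz)
  | succ t ih =>
    refine aemeasurable_pi_lambda _ fun m => ?_
    have h1 : AEMeasurable (fun ω => (E.finiteBattery (z ω) t, (z ω m).1)) P :=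
      ih.prodMk (measurable_fst.comp ((measurable_pi_apply m).comp hz)).aemeasurable
    refine ((measurable_step_empMeasure hE t hM m).comp_aemeasurable h1).congr ?_
    filter_upwards [hr] with ω hω
    have h2 : ∀ n, (Set.projIcc 0 E.Cmax (hE.Cmin_nonneg.trans hE.Cmin_lt.le)
        (E.finiteBattery (z ω) t n) : ℝ) = E.finiteBattery (z ω) t n := fun n => by
      rw [Set.projIcc_of_mem _ (finiteBattery_mem hω t n)]
    simp only [Function.comp_apply, h2]
    rfl

theorem aemeasurable_flowDist (hE : E.Valid) {Ω : Type*} [MeasurableSpace Ω]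
    {P : Measure Ω} {M : ℕ} (hM : M ≠ 0) {z : Ω → Fin M → Θ × ℝ} (hz : Measurable z)
    (hr : ∀ᵐ ω ∂P, ∀ m, (z ω m).2 ∈ Set.Icc 0 E.Cmax) {ν : ℕ → Measure ℝ}
    (hν : ∀ t, OnBattery E.Cmax (ν t)) :
    AEMeasurable (fun ω => flowDist E.T (E.empFlow (z ω)) ν) P := by
  refine AEMeasurable.iSup fun t => ?_
  have := (hν t).1
  exact (continuous_W1_empMeasure hM (hν t).integrable).measurable.comp_aemeasurable
    (aemeasurable_finiteBattery hE hM hz hr t)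

end EnergyModel

/-! ### Sampling error of empirical measures -/

section Sampling

variable {Ω : Type*}

/-- The fraction of the first `M` samples that exceed `x`. -/
noncomputable def sampleTail (X : ℕ → Ω → ℝ) (M : ℕ) (ω : Ω) (x : ℝ) : ℝ :=
  (M : ℝ)⁻¹ * ∑ m : Fin M, (Set.Ioi x).indicator (fun _ => 1) (X m ω)

theorem sampleTail_mem (X : ℕ → Ω → ℝ) (M : ℕ) (ω : Ω) (x : ℝ) :
    sampleTail X M ω x ∈ Set.Icc 0 1 := by
  have h0 : ∀ c : ℝ, 0 ≤ (Set.Ioi x).indicator (fun _ => (1 : ℝ)) c := fun c =>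
    Set.indicator_nonneg (fun _ _ => zero_le_one) c
  have h1 : ∀ c : ℝ, (Set.Ioi x).indicator (fun _ => (1 : ℝ)) c ≤ 1 := fun c =>
    Set.indicator_le_self' (fun _ _ => zero_le_one) c
  refine ⟨mul_nonneg (by positivity) (Finset.sum_nonneg fun m _ => h0 _), ?_⟩
  rw [sampleTail, ← div_eq_inv_mul]
  refine div_le_one_of_le₀ ?_ (by positivity)
  simpa using Finset.sum_le_sum (s := Finset.univ) fun (m : Fin M) _ => h1 (X m ω)

theorem abs_sampleTail_sub_le (X : ℕ → Ω → ℝ) (M : ℕ) (ω : Ω) (x : ℝ) (μ : Measure ℝ)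
    [IsProbabilityMeasure μ] : |sampleTail X M ω x - μ.real (Set.Ioi x)| ≤ 1 := by
  have h1 := sampleTail_mem X M ω x
  have h2 : μ.real (Set.Ioi x) ≤ 1 := measureReal_le_one
  have h3 : 0 ≤ μ.real (Set.Ioi x) := measureReal_nonneg
  rw [abs_le]
  constructor <;> linarith [h1.1, h1.2]

variable [MeasurableSpace Ω] {P : Measure Ω}

/-- This is the nonnegativity of the variance of `|Y|`. -/
theorem integral_abs_le_sqrt [IsProbabilityMeasure P] {Y : Ω → ℝ} (hY : MemLp Y 2 P) :
    ∫ ω, |Y ω| ∂P ≤ Real.sqrt (∫ ω, Y ω ^ 2 ∂P) := by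
  refine Real.le_sqrt_of_sq_le ?_
  have h1 := variance_nonneg (fun ω => |Y ω|) P
  rw [variance_eq_sub (by simpa using hY.norm)] at h1
  simpa using h1

theorem measurable_sampleTail {X : ℕ → Ω → ℝ} (hX : ∀ m, Measurable (X m)) (M : ℕ) :
    Measurable fun q : Ω × ℝ => sampleTail X M q.1 q.2 := by
  unfold sampleTail
  refine (Finset.measurable_sum _ fun m _ => ?_).const_mul _
  have h : (fun q : Ω × ℝ => (Set.Ioi q.2).indicator (fun _ => (1 : ℝ)) (X m q.1)) =
      {q : Ω × ℝ | q.2 < X m q.1}.indicator fun _ => 1 := by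
    ext q
    simp [Set.indicator]
  rw [h]
  exact measurable_const.indicator (measurableSet_lt measurable_snd ((hX m).comp measurable_fst))

theorem measurable_tail (μ : Measure ℝ) [IsProbabilityMeasure μ] :
    Measurable fun x => μ.real (Set.Ioi x) :=
  Antitone.measurable fun _ _ hxy => measureReal_mono (Set.Ioi_subset_Ioi hxy)

variable {X : ℕ → Ω → ℝ} {μ : Measure ℝ} {R : ℝ}

theorem integral_indicator_sample
    (hX : ∀ m, Measurable (X m)) (hl : ∀ m, P.map (X m) = μ) (m : ℕ) (x : ℝ) :
    ∫ ω, (Set.Ioi x).indicator (fun _ => (1 : ℝ)) (X m ω) ∂P = μ.real (Set.Ioi x) := by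
  have h := integral_map (μ := P) (hX m).aemeasurable
    (f := (Set.Ioi x).indicator fun _ => (1 : ℝ))
    (measurable_const.indicator measurableSet_Ioi).aestronglyMeasurable
  rw [← h, hl m, integral_indicator measurableSet_Ioi]
  simp

theorem memLp_indicator_sample [IsProbabilityMeasure P]
    (hX : ∀ m, Measurable (X m)) (m : ℕ) (x : ℝ) :
    MemLp (fun ω => (Set.Ioi x).indicator (fun _ => (1 : ℝ)) (X m ω)) 2 P := by
  refine MemLp.of_bound ((measurable_const.indicator measurableSet_Ioi).comp
    (hX m)).aestronglyMeasurable 1 (ae_of_all _ fun ω => ?_)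
  rw [Set.indicator]
  split_ifs <;> simp

/-- Independent indicators have variance at most `1` each, so their sum has standard deviation at
most `√M`. The bound does not depend on `x`, so it can be integrated over thresholds. -/
theorem integral_abs_sampleTail_sub_le [IsProbabilityMeasure P]
    (hX : ∀ m, Measurable (X m)) (hi : iIndepFun X P) (hl : ∀ m, P.map (X m) = μ)
    {M : ℕ} (hM : M ≠ 0) (x : ℝ) :
    ∫ ω, |sampleTail X M ω x - μ.real (Set.Ioi x)| ∂P ≤ 1 / Real.sqrt M := by
  have hMpos : (0 : ℝ) < M := by exact_mod_cast Nat.pos_of_ne_zero hM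
  set Y : ℕ → Ω → ℝ := fun m ω => (Set.Ioi x).indicator (fun _ => (1 : ℝ)) (X m ω) with hY
  have hYm : ∀ m, MemLp (Y m) 2 P := fun m => memLp_indicator_sample hX m x
  have hYi : iIndepFun Y P := hi.comp (fun _ => (Set.Ioi x).indicator fun _ => (1 : ℝ))
    fun _ => measurable_const.indicator measurableSet_Ioi
  have hE : ∀ m, ∫ ω, Y m ω ∂P = μ.real (Set.Ioi x) := fun m => integral_indicator_sample hX hl m x
  have hvar : ∀ m, variance (Y m) P ≤ 1 := by
    intro m
    refine (variance_le_expectation_sq (hYm m).aestronglyMeasurable).trans ?_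
    have : ∫ ω, (Y m ^ 2) ω ∂P ≤ ∫ _, (1 : ℝ) ∂P := by
      refine integral_mono (hYm m).integrable_sq (integrable_const _) fun ω => ?_
      simp only [Pi.pow_apply, hY, Set.indicator]
      split_ifs <;> simp
    simpa using this
  have hsum := IndepFun.variance_sum (s := Finset.range M) (fun i _ => hYm i)
    fun i _ j _ hij => hYi.indepFun hij
  have hS : MemLp (∑ i ∈ Finset.range M, Y i) 2 P := memLp_finsetSum' _ fun i _ => hYm i
  have hES : ∫ ω, (∑ i ∈ Finset.range M, Y i) ω ∂P = M * μ.real (Set.Ioi x) := by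
    simp only [Finset.sum_apply]
    rw [integral_finsetSum _ fun i _ => (hYm i).integrable one_le_two]
    simp [hE]
  have hle : ∫ ω, ((∑ i ∈ Finset.range M, Y i) ω - M * μ.real (Set.Ioi x)) ^ 2 ∂P ≤ M := by
    rw [← hES, ← variance_eq_integral hS.aestronglyMeasurable.aemeasurable, hsum]
    simpa using Finset.sum_le_sum (s := Finset.range M) fun i _ => hvar i
  have heq : ∀ ω, |sampleTail X M ω x - μ.real (Set.Ioi x)| =
      (M : ℝ)⁻¹ * |(∑ i ∈ Finset.range M, Y i) ω - M * μ.real (Set.Ioi x)| := by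
    intro ω
    rw [Finset.sum_apply, sampleTail, Fin.sum_univ_eq_sum_range fun i => Y i ω]
    conv_rhs => rw [← abs_of_pos (inv_pos.2 hMpos), ← abs_mul]
    congr 1
    field_simp
  simp only [heq]
  rw [integral_const_mul]
  calc (M : ℝ)⁻¹ * ∫ ω, |(∑ i ∈ Finset.range M, Y i) ω - M * μ.real (Set.Ioi x)| ∂P
      ≤ (M : ℝ)⁻¹ * Real.sqrt M := by
        refine mul_le_mul_of_nonneg_left ?_ (by positivity)
        exact (integral_abs_le_sqrt (hS.sub (memLp_const _))).trans (Real.sqrt_le_sqrt hle)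
    _ = 1 / Real.sqrt M := by
        rw [← div_eq_inv_mul, Real.sqrt_div_self']

theorem ae_W1_sample_le
    (hX : ∀ m, Measurable (X m)) (hl : ∀ m, P.map (X m) = μ)
    (hμ : OnBattery R μ) :
    ∀ᵐ ω ∂P, ∀ M : ℕ, M ≠ 0 → W1 (empMeasure fun m : Fin M => X m ω) μ ≤
      ∫ x in Set.Ioc 0 R, |sampleTail X M ω x - μ.real (Set.Ioi x)| := by
  have h : ∀ᵐ ω ∂P, ∀ m, X m ω ∈ Set.Icc 0 R := by
    refine ae_all_iff.2 fun m => ae_of_ae_map (hX m).aemeasurable ?_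
    rw [hl m]
    exact hμ.2
  filter_upwards [h] with ω hω M hM
  have := W1_le_integral_tail (onBattery_empMeasure hM fun m : Fin M => hω m) hμ
  simpa only [tail_empMeasure, sampleTail] using this

theorem integrable_sampleTail_sub [IsProbabilityMeasure P]
    (hX : ∀ m, Measurable (X m)) (hμ : OnBattery R μ) (M : ℕ) :
    Integrable (fun q : Ω × ℝ => |sampleTail X M q.1 q.2 - μ.real (Set.Ioi q.2)|)
      (P.prod (volume.restrict (Set.Ioc 0 R))) := by
  have := hμ.1
  refine Integrable.of_bound ((measurable_sampleTail hX M).sub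
    ((measurable_tail μ).comp measurable_snd)).abs.aestronglyMeasurable 1
    (ae_of_all _ fun q => ?_)
  rw [Real.norm_eq_abs, abs_abs]
  exact abs_sampleTail_sub_le X M q.1 q.2 μ

/-- The mean Wasserstein distance of an empirical measure on `[0, R]` to the sampled law. -/
theorem integral_W1_sample_le [IsProbabilityMeasure P]
    (hX : ∀ m, Measurable (X m)) (hi : iIndepFun X P) (hl : ∀ m, P.map (X m) = μ)
    (hμ : OnBattery R μ) (hR : 0 ≤ R) {M : ℕ} (hM : M ≠ 0) :
    Integrable (fun ω => W1 (empMeasure fun m : Fin M => X m ω) μ) P ∧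
      ∫ ω, W1 (empMeasure fun m : Fin M => X m ω) μ ∂P ≤ R / Real.sqrt M := by
  have := hμ.1
  have hint := integrable_sampleTail_sub (P := P) hX hμ M
  have hle : ∀ᵐ ω ∂P, W1 (empMeasure fun m : Fin M => X m ω) μ ≤
      ∫ x in Set.Ioc 0 R, |sampleTail X M ω x - μ.real (Set.Ioi x)| := by
    filter_upwards [ae_W1_sample_le hX hl hμ] with ω hω using hω M hM
  have hm : Measurable fun ω => W1 (empMeasure fun m : Fin M => X m ω) μ :=
    (continuous_W1_empMeasure hM hμ.integrable).measurable.comp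
      (measurable_pi_lambda _ fun m => hX m)
  have hW : Integrable (fun ω => W1 (empMeasure fun m : Fin M => X m ω) μ) P := by
    refine Integrable.mono' hint.integral_prod_left hm.aestronglyMeasurable ?_
    filter_upwards [hle] with ω hω
    rwa [Real.norm_eq_abs, abs_of_nonneg (W1_nonneg _ _)]
  refine ⟨hW, (integral_mono_ae hW hint.integral_prod_left hle).trans ?_⟩
  rw [integral_integral_swap hint]
  calc ∫ x in Set.Ioc 0 R, ∫ ω, |sampleTail X M ω x - μ.real (Set.Ioi x)| ∂P
      ≤ ∫ _ in Set.Ioc 0 R, 1 / Real.sqrt M :=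
        integral_mono hint.integral_prod_right (integrable_const _) fun x =>
          integral_abs_sampleTail_sub_le hX hi hl hM x
    _ = R / Real.sqrt M := by
        simp [hR, div_eq_mul_inv]

/-- The empirical measures converge almost surely to the sampled law. -/
theorem ae_tendsto_W1_sample [IsProbabilityMeasure P]
    (hX : ∀ m, Measurable (X m)) (hi : iIndepFun X P) (hl : ∀ m, P.map (X m) = μ)
    (hμ : OnBattery R μ) :
    ∀ᵐ ω ∂P, Tendsto (fun M : ℕ => W1 (empMeasure fun m : Fin M => X m ω) μ) atTop (𝓝 0) := by
  have := hμ.1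
  have hx : ∀ x : ℝ, ∀ᵐ ω ∂P, Tendsto (fun M => sampleTail X M ω x - μ.real (Set.Ioi x))
      atTop (𝓝 0) := by
    intro x
    have hg : Measurable ((Set.Ioi x).indicator fun _ => (1 : ℝ)) :=
      measurable_const.indicator measurableSet_Ioi
    have hslln := strong_law_ae_real (μ := P)
      (fun m ω => (Set.Ioi x).indicator (fun _ => (1 : ℝ)) (X m ω))
      ((memLp_indicator_sample hX 0 x).integrable one_le_two)
      (fun i j hij => (hi.comp (fun _ => (Set.Ioi x).indicator fun _ => (1 : ℝ))
        fun _ => hg).indepFun hij)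
      (fun i => IdentDistrib.comp ⟨(hX i).aemeasurable, (hX 0).aemeasurable,
        (hl i).trans (hl 0).symm⟩ hg)
    filter_upwards [hslln] with ω hω
    rw [integral_indicator_sample hX hl] at hω
    rw [← sub_self (μ.real (Set.Ioi x))]
    refine Tendsto.sub_const (hω.congr fun M => ?_) _
    rw [sampleTail, Fin.sum_univ_eq_sum_range
      fun i => (Set.Ioi x).indicator (fun _ => (1 : ℝ)) (X i ω), div_eq_inv_mul]
  -- The null set in the strong law depends on `x`. Since the convergence set is measurable, Fubini
  -- exchanges the quantifiers: almost surely there is convergence at almost every `x`, enough for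
  -- dominated convergence.
  have hms : MeasurableSet {q : ℝ × Ω |
      Tendsto (fun M => sampleTail X M q.2 q.1 - μ.real (Set.Ioi q.1)) atTop (𝓝 0)} :=
    measurableSet_tendsto _ fun M => ((measurable_sampleTail hX M).comp measurable_swap).sub
      ((measurable_tail μ).comp measurable_fst)
  have hω := (Measure.ae_ae_comm (μ := volume.restrict (Set.Ioc 0 R)) (ν := P) hms).1
    (ae_of_all _ hx)
  filter_upwards [hω, ae_W1_sample_le hX hl hμ] with ω h1 h2
  have h3 : Tendsto (fun M : ℕ => ∫ x in Set.Ioc 0 R,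
      |sampleTail X M ω x - μ.real (Set.Ioi x)|) atTop (𝓝 0) := by
    have := tendsto_integral_of_dominated_convergence (μ := volume.restrict (Set.Ioc 0 R))
      (F := fun M x => |sampleTail X M ω x - μ.real (Set.Ioi x)|) (f := fun _ => 0)
      (fun _ => (1 : ℝ))
      (fun M => (((measurable_sampleTail hX M).comp measurable_prodMk_left).sub
        (measurable_tail μ)).abs.aestronglyMeasurable)
      (integrable_const _)
      (fun M => ae_of_all _ fun x => by
        rw [Real.norm_eq_abs, abs_abs]; exact abs_sampleTail_sub_le X M ω x μ)
      (by filter_upwards [h1] with x hx; simpa using hx.abs)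
    simpa using this
  refine squeeze_zero' (Eventually.of_forall fun _ => W1_nonneg _ _) ?_ h3
  filter_upwards [eventually_ne_atTop 0] with M hM using h2 M hM

end Sampling

/-! ### The game -/

/-- Quantitative strong convexity of the power-rate mapping on nonnegative rates. -/
theorem two_rpow_strongConvex {B : ℝ} (hB : 0 < B) {r r' s : ℝ} (hr : 0 ≤ r) (hr' : 0 ≤ r')
    (hs : s ∈ Set.Icc (0 : ℝ) 1) :
    (2 : ℝ) ^ (((1 - s) * r + s * r') / B) +
        (1 - s) * s * ((Real.log 2 / B) ^ 2 / 2) * (r - r') ^ 2 ≤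
      (1 - s) * (2 : ℝ) ^ (r / B) + s * (2 : ℝ) ^ (r' / B) := by
  set k := Real.log 2 / B with hk
  have hk0 : 0 ≤ k := div_nonneg (Real.log_nonneg one_le_two) hB.le
  have hpow : ∀ x : ℝ, (2 : ℝ) ^ (x / B) = Real.exp (k * x) := fun x => by
    rw [Real.rpow_def_of_pos two_pos, hk]; congr 1; ring
  -- The second derivative is `k² (exp (k x) - 1)`, nonnegative exactly because rates are
  -- nonnegative.
  have hconv : ConvexOn ℝ (Set.Ici 0) fun x : ℝ => Real.exp (k * x) - k ^ 2 / 2 * x ^ 2 := by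
    have hd : ∀ x : ℝ, HasDerivAt (fun x : ℝ => Real.exp (k * x) - k ^ 2 / 2 * x ^ 2)
        (k * Real.exp (k * x) - k ^ 2 * x) x := by
      intro x
      have h1 := ((hasDerivAt_id x).const_mul k).exp
      have h2 := ((hasDerivAt_id x).pow 2).const_mul (k ^ 2 / 2)
      refine (h1.sub h2).congr_deriv ?_
      simp only [id]
      ring
    have hd2 : ∀ x : ℝ, HasDerivAt (fun x : ℝ => k * Real.exp (k * x) - k ^ 2 * x)
        (k ^ 2 * (Real.exp (k * x) - 1)) x := by
      intro x
      have h1 := (((hasDerivAt_id x).const_mul k).exp).const_mul k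
      have h2 := (hasDerivAt_id x).const_mul (k ^ 2)
      refine (h1.sub h2).congr_deriv ?_
      simp only [id]
      ring
    refine convexOn_of_hasDerivWithinAt2_nonneg (convex_Ici 0)
      (fun x _ => (hd x).continuousAt.continuousWithinAt)
      (fun x _ => (hd x).hasDerivWithinAt) (fun x _ => (hd2 x).hasDerivWithinAt) fun x hx => ?_
    rw [interior_Ici, Set.mem_Ioi] at hx
    have : 1 ≤ Real.exp (k * x) := Real.one_le_exp (by positivity)
    exact mul_nonneg (sq_nonneg _) (by linarith)
  have h := hconv.2 (Set.mem_Ici.2 hr) (Set.mem_Ici.2 hr') (sub_nonneg.2 hs.2) hs.1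
    (sub_add_cancel 1 s)
  simp only [smul_eq_mul] at h
  simp only [hpow]
  nlinarith [h]

namespace Game

variable {T M : ℕ} {Θ : Type*} {G : Game T M} {p : Params} {E : EnergyModel Θ}

/-- A lower bound of the coefficient `κ` on links. -/
noncomputable def kappaMin (p : Params) : ℝ :=
  p.boltz * p.temp * p.band / (p.gainMax * p.gainMax) *
    (4 * Real.pi * p.distMin * p.freq / p.light) ^ 2

theorem kappaMin_pos (hp : p.Valid) : 0 < kappaMin p := by
  obtain ⟨h1, h2, h3, h4, h5, h6, h7, h8, h9, h10⟩ := hp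
  have := Real.pi_pos
  unfold kappaMin
  positivity

theorem kappa_of_notMem {m n : Fin M} {t : Fin T} (h : n ∉ G.nbr m t) : G.kappa p m n t = 0 := by
  simp [kappa, adj, h]

theorem kappaMin_le (hp : p.Valid) (hG : G.Admissible p) {m n : Fin M} {t : Fin T}
    (h : n ∈ G.nbr m t) : kappaMin p ≤ G.kappa p m n t := by
  obtain ⟨h1, h2, h3, h4, h5, h6, h7, h8, h9, h10⟩ := hp
  have hm := hG.gain_pos m
  have hn := hG.gain_pos n
  have hm' := hG.gain_le m
  have hn' := hG.gain_le n
  have hd := hG.dist_ge m t n h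
  have := Real.pi_pos
  simp only [kappa, adj, if_pos h, one_mul, kappaMin]
  gcongr

theorem kappa_nonneg (hp : p.Valid) (hG : G.Admissible p) (m n : Fin M) (t : Fin T) :
    0 ≤ G.kappa p m n t := by
  by_cases h : n ∈ G.nbr m t
  · exact (kappaMin_pos hp).le.trans (kappaMin_le hp hG h)
  · exact (kappa_of_notMem h).ge

theorem power_nonneg (hp : p.Valid) (hG : G.Admissible p) (m n : Fin M) (t : Fin T) {r : ℝ}
    (hr : 0 ≤ r) : 0 ≤ G.power p m n t r :=
  mul_nonneg (kappa_nonneg hp hG m n t) (sub_nonneg.2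
    (Real.one_le_rpow one_le_two (div_nonneg hr hp.band_pos.le)))

theorem power_of_notMem {m n : Fin M} {t : Fin T} (h : n ∉ G.nbr m t) (r : ℝ) :
    G.power p m n t r = 0 := by
  rw [power, kappa_of_notMem h, zero_mul]

theorem rate_nonneg {θ : Θ} {m : Fin M} {t : Fin T} {x : G.SlotAction}
    (hx : x ∈ G.slotSet p E θ m t) (n : Fin M) : 0 ≤ G.rate x n :=
  Finset.sum_nonneg fun w _ => hx.1 w n

theorem rate_of_notMem {θ : Θ} {m n : Fin M} {t : Fin T} {x : G.SlotAction}
    (hx : x ∈ G.slotSet p E θ m t) (h : n ∉ G.nbr m t) : G.rate x n = 0 :=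
  Finset.sum_eq_zero fun w _ => hx.2.1 w n h

theorem rate_mix (x x' : G.SlotAction) (s : ℝ) (n : Fin M) :
    G.rate ((1 - s) • x + s • x') n = (1 - s) * G.rate x n + s * G.rate x' n := by
  simp [rate, Finset.sum_add_distrib, Finset.mul_sum]

theorem powerCeiling_le (Pmax : ℝ) (θ : Θ) (t : ℕ) (q d : ℝ) :
    E.powerCeiling Pmax θ t q d ≤ Pmax := by
  unfold EnergyModel.powerCeiling
  split_ifs <;> exact min_le_right _ _

theorem totalPower_nonneg (hp : p.Valid) (hG : G.Admissible p) {θ : Θ} {m : Fin M} {t : Fin T}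
    {x : G.SlotAction} (hx : x ∈ G.slotSet p E θ m t) : 0 ≤ G.totalPower p m t x :=
  Finset.sum_nonneg fun n _ => power_nonneg hp hG m n t (rate_nonneg hx n)

theorem totalPower_le (hp : p.Valid) (hG : G.Admissible p) {θ : Θ} {m : Fin M} {t : Fin T}
    {x : G.SlotAction} (hx : x ∈ G.slotSet p E θ m t) :
    G.totalPower p m t x ≤ p.maxDeg * p.Pmax := by
  have h1 : G.totalPower p m t x = ∑ n ∈ G.nbr m t, G.power p m n t (G.rate x n) :=
    (Finset.sum_subset (Finset.subset_univ _) fun n _ hn => power_of_notMem hn _).symm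
  have h2 : ∀ n ∈ G.nbr m t, G.power p m n t (G.rate x n) ≤ p.Pmax := fun n hn => by
    refine (hx.2.2 n).trans ?_
    rw [adj, if_pos hn, one_mul]
    exact powerCeiling_le _ _ _ _ _
  rw [h1]
  refine (Finset.sum_le_card_nsmul _ _ _ h2).trans ?_
  rw [nsmul_eq_mul]
  have := hp.Pmax_pos
  have := hG.card_le m t
  gcongr

/-- On links `κ ≥ kappaMin` supplies the modulus. Off links `κ = 0`, but feasible rates vanish there
too, so nothing is lost. -/
theorem power_mix_le (hp : p.Valid) (hG : G.Admissible p) {θ : Θ} {m : Fin M} {t : Fin T}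
    {x x' : G.SlotAction} (hx : x ∈ G.slotSet p E θ m t) (hx' : x' ∈ G.slotSet p E θ m t) {s : ℝ}
    (hs : s ∈ Set.Icc (0 : ℝ) 1) (n : Fin M) :
    G.power p m n t (G.rate ((1 - s) • x + s • x') n) +
        (1 - s) * s * (kappaMin p * (Real.log 2 / p.band) ^ 2 / 2) *
          (G.rate x n - G.rate x' n) ^ 2 ≤
      (1 - s) * G.power p m n t (G.rate x n) + s * G.power p m n t (G.rate x' n) := by
  by_cases h : n ∈ G.nbr m t
  · have h1 := two_rpow_strongConvex hp.band_pos (rate_nonneg hx n) (rate_nonneg hx' n) hs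
    have h2 := mul_le_mul_of_nonneg_left h1 (kappa_nonneg hp hG m n t)
    have h3 : 0 ≤ (1 - s) * s * ((Real.log 2 / p.band) ^ 2 / 2) *
        (G.rate x n - G.rate x' n) ^ 2 :=
      mul_nonneg (mul_nonneg (mul_nonneg (sub_nonneg.2 hs.2) hs.1) (by positivity)) (sq_nonneg _)
    have h4 := mul_le_mul_of_nonneg_right (kappaMin_le hp hG h) h3
    rw [rate_mix]
    simp only [power]
    linarith
  · simp [power_of_notMem h, rate_of_notMem hx h, rate_of_notMem hx' h]

theorem totalPower_mix_le (hp : p.Valid) (hG : G.Admissible p) {θ : Θ} {m : Fin M} {t : Fin T}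
    {x x' : G.SlotAction} (hx : x ∈ G.slotSet p E θ m t) (hx' : x' ∈ G.slotSet p E θ m t) {s : ℝ}
    (hs : s ∈ Set.Icc (0 : ℝ) 1) :
    G.totalPower p m t ((1 - s) • x + s • x') +
        (1 - s) * s * (kappaMin p * (Real.log 2 / p.band) ^ 2 / 2) *
          ∑ n, (G.rate x n - G.rate x' n) ^ 2 ≤
      (1 - s) * G.totalPower p m t x + s * G.totalPower p m t x' := by
  simp only [totalPower, Finset.mul_sum]
  rw [← Finset.sum_add_distrib, ← Finset.sum_add_distrib]
  exact Finset.sum_le_sum fun n _ => power_mix_le hp hG hx hx' hs n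

theorem mix_mem_slotSet (hp : p.Valid) (hG : G.Admissible p) {θ : Θ} {m : Fin M} {t : Fin T}
    {x x' : G.SlotAction} (hx : x ∈ G.slotSet p E θ m t) (hx' : x' ∈ G.slotSet p E θ m t) {s : ℝ}
    (hs : s ∈ Set.Icc (0 : ℝ) 1) : (1 - s) • x + s • x' ∈ G.slotSet p E θ m t := by
  have h1s : 0 ≤ 1 - s := sub_nonneg.2 hs.2
  refine ⟨fun w n => ?_, fun w n h => ?_, fun n => ?_⟩
  · exact add_nonneg (mul_nonneg h1s (hx.1 w n)) (mul_nonneg hs.1 (hx'.1 w n))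
  · simp [hx.2.1 w n h, hx'.2.1 w n h]
  · have h1 := power_mix_le hp hG hx hx' hs n
    have h2 : 0 ≤ (1 - s) * s * (kappaMin p * (Real.log 2 / p.band) ^ 2 / 2) *
        (G.rate x n - G.rate x' n) ^ 2 := by
      have := (kappaMin_pos hp).le
      have := hs.1
      positivity
    have h3 := mul_le_mul_of_nonneg_left (hx.2.2 n) h1s
    have h4 := mul_le_mul_of_nonneg_left (hx'.2.2 n) hs.1
    linarith

/-- The modulus of strong concavity of the potential. -/
noncomputable def concavityModulus (p : Params) (E : EnergyModel Θ) : ℝ :=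
  p.alpha * E.De * (kappaMin p * (Real.log 2 / p.band) ^ 2)

theorem balance_mix (m : Fin M) (x x' : Fin M → ℝ) (s : ℝ) (l : Fin M) :
    balance m ((1 - s) • x + s • x') l = (1 - s) * balance m x l + s * balance m x' l := by
  unfold balance
  split_ifs
  · simp only [Pi.add_apply, Pi.smul_apply, smul_eq_mul, Finset.sum_add_distrib, ← Finset.mul_sum]
    ring
  · simp only [Pi.add_apply, Pi.smul_apply, smul_eq_mul]
    ring

/-- Throughput and flow balance are linear. The modulus comes from the energy cost alone; the
battery penalty contributes only its concavity, which keeps the modulus independent of battery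
levels and of `lam`. -/
theorem slotPayoff_mix_ge (hp : p.Valid) (hG : G.Admissible p) (hDe : 0 < E.De) {θ : Θ}
    {m : Fin M} {t : Fin T} {c : ℝ} (hc : 0 < c - E.Cmin + E.eps) {x x' : G.SlotAction}
    (hx : x ∈ G.slotSet p E θ m t) (hx' : x' ∈ G.slotSet p E θ m t) {s : ℝ}
    (hs : s ∈ Set.Icc (0 : ℝ) 1) :
    (1 - s) * G.slotPayoff p E m t c x + s * G.slotPayoff p E m t c x' +
        (1 - s) * s * (concavityModulus p E / 2) * ∑ n, (G.rate x n - G.rate x' n) ^ 2 ≤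
      G.slotPayoff p E m t c ((1 - s) • x + s • x') := by
  have h1s : 0 ≤ 1 - s := sub_nonneg.2 hs.2
  have hTP := totalPower_mix_le hp hG hx hx' hs
  have hrate : ∑ n, G.rate ((1 - s) • x + s • x') n =
      (1 - s) * ∑ n, G.rate x n + s * ∑ n, G.rate x' n := by
    simp only [rate_mix, Finset.sum_add_distrib, Finset.mul_sum]
  have hbal : ∑ w, ∑ l, G.mult w l t * balance m (((1 - s) • x + s • x') w) l =
      (1 - s) * ∑ w, ∑ l, G.mult w l t * balance m (x w) l +
        s * ∑ w, ∑ l, G.mult w l t * balance m (x' w) l := by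
    simp only [Finset.mul_sum, ← Finset.sum_add_distrib]
    refine Finset.sum_congr rfl fun w _ => Finset.sum_congr rfl fun l _ => ?_
    have : ((1 - s) • x + s • x') w = (1 - s) • x w + s • x' w := rfl
    rw [this, balance_mix]
    ring
  simp only [slotPayoff, hrate, hbal, concavityModulus]
  set D := ∑ n, (G.rate x n - G.rate x' n) ^ 2
  have hD : 0 ≤ D := Finset.sum_nonneg fun _ _ => sq_nonneg _
  have hC : 0 ≤ (1 - s) * s * (kappaMin p * (Real.log 2 / p.band) ^ 2 / 2) * D := by
    have := (kappaMin_pos hp).le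
    have := hs.1
    positivity
  have h1 := mul_le_mul_of_nonneg_left hTP (mul_pos hp.alpha_pos hDe).le
  have h2 := mul_le_mul_of_nonneg_left ((le_add_of_nonneg_right hC).trans hTP)
    (div_nonneg (hG.lam_pos m t).le hc.le)
  simp only [mul_div_right_comm]
  linarith

/-- The payoff of a strategy of satellite `m` along the battery levels `b`. -/
noncomputable def payoff (G : Game T M) (p : Params) (E : EnergyModel Θ) (b : Fin T → ℝ)
    (m : Fin M) (y : G.Strategy) : ℝ :=
  ∑ t, G.slotPayoff p E m t (b t) (y t)

theorem utility_eq_payoff (z : Fin M → Θ × ℝ) (μ : ℕ → Measure ℝ) (m : Fin M) (Y : G.Profile) :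
    G.utility p E z μ m Y = G.payoff p E (fun t => E.battery (z m) μ t) m (Y m) := rfl

theorem potential_eq_sum (z : Fin M → Θ × ℝ) (μ : ℕ → Measure ℝ) (Y : G.Profile) :
    G.potential p E z μ Y = ∑ m, G.payoff p E (fun t => E.battery (z m) μ t) m (Y m) := by
  simp only [potential, payoff, slotPayoff, Finset.sum_sub_distrib, Finset.mul_sum]

/-- Payoffs are separable, so a unilateral deviation changes only one summand of the potential. -/
theorem potential_update (z : Fin M → Θ × ℝ) (μ : ℕ → Measure ℝ) (Y : G.Profile) (m : Fin M)
    (y : G.Strategy) : G.potential p E z μ (Function.update Y m y) =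
      G.potential p E z μ Y - G.payoff p E (fun t => E.battery (z m) μ t) m (Y m) +
        G.payoff p E (fun t => E.battery (z m) μ t) m y := by
  rw [potential_eq_sum, potential_eq_sum, ← Finset.add_sum_erase _ _ (Finset.mem_univ m),
    ← Finset.add_sum_erase (a := m) Finset.univ (fun n => G.payoff p E _ n (Y n))
      (Finset.mem_univ m), Function.update_self]
  have : ∀ n ∈ Finset.univ.erase m,
      G.payoff p E (fun t => E.battery (z n) μ t) n (Function.update Y m y n) =
        G.payoff p E (fun t => E.battery (z n) μ t) n (Y n) := fun n hn => by
    rw [Function.update_of_ne (Finset.ne_of_mem_erase hn)]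
  rw [Finset.sum_congr rfl this]
  ring

theorem sum_rateDistSq_update (Y : G.Profile) (m : Fin M) (y : G.Strategy) :
    ∑ n, G.rateDistSq (Y n) (Function.update Y m y n) = G.rateDistSq (Y m) y := by
  rw [Finset.sum_eq_single_of_mem m (Finset.mem_univ m) fun n _ hn => ?_, Function.update_self]
  rw [Function.update_of_ne hn]
  simp [rateDistSq]

theorem mix_update (Y : G.Profile) (m : Fin M) (y : G.Strategy) (s : ℝ) :
    (1 - s) • Y + s • Function.update Y m y = Function.update Y m ((1 - s) • Y m + s • y) := by
  ext n : 1
  by_cases h : n = m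
  · subst h
    simp
  · simp only [Pi.add_apply, Pi.smul_apply, Function.update_of_ne h, ← add_smul,
      sub_add_cancel, one_smul]

theorem mix_mem_strategySet (hp : p.Valid) (hG : G.Admissible p) {θ : Θ} {m : Fin M}
    {y y' : G.Strategy} (hy : y ∈ G.strategySet p E θ m) (hy' : y' ∈ G.strategySet p E θ m) {s : ℝ}
    (hs : s ∈ Set.Icc (0 : ℝ) 1) : (1 - s) • y + s • y' ∈ G.strategySet p E θ m :=
  fun t => mix_mem_slotSet hp hG (hy t) (hy' t) hs

theorem concavityModulus_pos (hp : p.Valid) (hDe : 0 < E.De) : 0 < concavityModulus p E := by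
  have h1 := hp.alpha_pos
  have h2 := kappaMin_pos hp
  have h3 := hp.band_pos
  have h4 := Real.log_pos one_lt_two
  unfold concavityModulus
  positivity

theorem potentialStronglyConcave (hp : p.Valid) (hG : G.Admissible p) (hDe : 0 < E.De)
    {z : Fin M → Θ × ℝ} {μ : ℕ → Measure ℝ}
    (hm : ∀ (m : Fin M) (t : Fin T), 0 < E.battery (z m) μ t - E.Cmin + E.eps) :
    G.PotentialStronglyConcave p E (concavityModulus p E) z μ := by
  intro Y Y' hY hY' s hs
  simp only [potential_eq_sum, payoff, rateDistSq, Finset.mul_sum, ← Finset.sum_add_distrib]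
  refine Finset.sum_le_sum fun m _ => Finset.sum_le_sum fun t _ => ?_
  rw [← Finset.mul_sum]
  exact slotPayoff_mix_ge hp hG hDe (hm m t) (hY m t) (hY' m t) hs

/-- In the double difference everything but the penalty cancels. Both total powers lie in `[0,
maxDeg * Pmax]`, so their difference costs this bound once rather than twice; hence the loss `δ / 2`
later on. -/
theorem slotPayoff_gap_le (hp : p.Valid) (hG : G.Admissible p) {θ : Θ} {m : Fin M} {t : Fin T}
    {g c c' : ℝ} (hg : 0 < g) (hc : g ≤ c - E.Cmin + E.eps) (hc' : g ≤ c' - E.Cmin + E.eps)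
    {x x' : G.SlotAction} (hx : x ∈ G.slotSet p E θ m t) (hx' : x' ∈ G.slotSet p E θ m t) :
    (G.slotPayoff p E m t c x - G.slotPayoff p E m t c' x) -
        (G.slotPayoff p E m t c x' - G.slotPayoff p E m t c' x') ≤
      p.lamMax * (p.maxDeg * p.Pmax) / g ^ 2 * |c - c'| := by
  set d := c - E.Cmin + E.eps with hd
  set d' := c' - E.Cmin + E.eps with hd'
  have hdp : 0 < d := hg.trans_le hc
  have hdp' : 0 < d' := hg.trans_le hc'
  have heq : (G.slotPayoff p E m t c x - G.slotPayoff p E m t c' x) -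
        (G.slotPayoff p E m t c x' - G.slotPayoff p E m t c' x') =
      G.lam m t * (G.totalPower p m t x' - G.totalPower p m t x) * ((c' - c) / (d * d')) := by
    have : c' - c = d' - d := by rw [hd, hd']; ring
    rw [this]
    simp only [slotPayoff, ← hd, ← hd']
    field_simp
    ring
  have h1 : |G.totalPower p m t x' - G.totalPower p m t x| ≤ p.maxDeg * p.Pmax := by
    have := totalPower_nonneg hp hG hx
    have := totalPower_nonneg hp hG hx'
    have := totalPower_le hp hG hx
    have := totalPower_le hp hG hx'
    rw [abs_le]
    constructor <;> linarith
  have h2 : |(c' - c) / (d * d')| ≤ |c - c'| / g ^ 2 := by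
    rw [abs_div, abs_sub_comm, abs_of_pos (mul_pos hdp hdp'), sq]
    gcongr
  have h3 : 0 ≤ (p.maxDeg : ℝ) * p.Pmax := (abs_nonneg _).trans h1
  have h4 := (hG.lam_pos m t).le
  have h5 := hp.lamMax_pos.le
  rw [heq]
  refine (le_abs_self _).trans ?_
  rw [abs_mul, abs_mul, abs_of_nonneg h4]
  calc G.lam m t * |G.totalPower p m t x' - G.totalPower p m t x| * |(c' - c) / (d * d')|
      ≤ p.lamMax * (p.maxDeg * p.Pmax) * (|c - c'| / g ^ 2) := by
        have := hG.lam_le m t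
        gcongr
    _ = _ := by ring

/-- A strongly concave potential grows quadratically away from the mean-field strategy. -/
theorem rateDistSq_le_of_isMFEStrategy (hp : p.Valid) (hG : G.Admissible p)
    {z : Fin M → Θ × ℝ} {μ : ℕ → Measure ℝ} {k : ℝ} {Ys : G.Profile}
    (hYs : G.IsMFEStrategy p E k z μ Ys) {a : ℝ}
    (ha : G.PotentialStronglyConcave p E a z μ) {m : Fin M} {y : G.Strategy}
    (hy : y ∈ G.strategySet p E (z m).1 m) :
    a / 2 * G.rateDistSq (Ys m) y ≤ G.payoff p E (fun t => E.battery (z m) μ t) m (Ys m) -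
      G.payoff p E (fun t => E.battery (z m) μ t) m y := by
  set u := G.payoff p E (fun t => E.battery (z m) μ t) m with hu
  have hYmem : ∀ n, Ys n ∈ G.strategySet p E (z n).1 n := fun n t => (hYs n t).1
  -- The `W1` term of the Hamiltonian does not depend on the action and cancels; slotwise maxima add
  -- up because the strategy set is a product over slots.
  have hmax : ∀ v ∈ G.strategySet p E (z m).1 m, u v ≤ u (Ys m) := by
    intro v hv
    refine Finset.sum_le_sum fun t _ => ?_
    have := (hYs m t).2 (v t) (hv t)
    simpa only [hamiltonian, sub_le_sub_iff_right] using this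
  -- Strong concavity is applied on the segment from `Ys` to its deviation; the mixed point is
  -- feasible and pays no more than `Ys m`. Dividing by `s` and letting `s → 0` removes the factor
  -- `1 - s`.
  have key : ∀ s ∈ Set.Ioo (0 : ℝ) 1, (1 - s) * (a / 2 * G.rateDistSq (Ys m) y) ≤
      u (Ys m) - u y := by
    intro s hs
    have hs' : s ∈ Set.Icc (0 : ℝ) 1 := ⟨hs.1.le, hs.2.le⟩
    have h := ha Ys (Function.update Ys m y) hYmem (fun n => by
      by_cases hn : n = m
      · subst hn; rwa [Function.update_self]
      · rw [Function.update_of_ne hn]; exact hYmem n) s hs'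
    rw [sum_rateDistSq_update, mix_update, potential_update, potential_update, ← hu] at h
    have h2 := hmax _ (mix_mem_strategySet hp hG (hYmem m) hy hs')
    have h3 : s * ((1 - s) * (a / 2 * G.rateDistSq (Ys m) y)) ≤ s * (u (Ys m) - u y) := by
      linarith
    exact le_of_mul_le_mul_left h3 hs.1
  have hlim : Tendsto (fun s : ℝ => (1 - s) * (a / 2 * G.rateDistSq (Ys m) y)) (𝓝[>] 0)
      (𝓝 (a / 2 * G.rateDistSq (Ys m) y)) := by
    have : Continuous fun s : ℝ => (1 - s) * (a / 2 * G.rateDistSq (Ys m) y) := by fun_prop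
    simpa using (this.tendsto 0).mono_left nhdsWithin_le_nhds
  refine le_of_tendsto hlim ?_
  filter_upwards [Ioo_mem_nhdsGT (zero_lt_one (α := ℝ))] with s hs using key s hs

end Game

/-! ### Finite-player equilibria under the mean-field flow -/

section Gap

variable {M : ℕ} {Θ : Type*} [MeasurableSpace Θ] {E : EnergyModel Θ} {p : Params}
  {G : Game E.T M} {z : Fin M → Θ × ℝ} {μ : ℕ → Measure ℝ} {g : ℝ}

theorem lipU_nonneg (hE : E.Valid) (hp : p.Valid) (g : ℝ) : 0 ≤ lipU E p g := by
  have h1 := hp.lamMax_pos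
  have h2 := hp.Pmax_pos
  exact mul_nonneg (by positivity)
    (Finset.sum_nonneg fun t _ => EnergyModel.battLip_nonneg hE t)

theorem delta_nonneg (hE : E.Valid) (hp : p.Valid) (g : ℝ) (z : Fin M → Θ × ℝ)
    (μ : ℕ → Measure ℝ) : 0 ≤ delta E p g z μ :=
  mul_nonneg (mul_nonneg zero_le_two (lipU_nonneg hE hp g)) (flowDist_nonneg _ _ _)

namespace Game

/-- A finite-player equilibrium loses at most `δ / 2` under the mean-field flow. -/
theorem payoff_le_of_isFiniteNash (hE : E.Valid) (hp : p.Valid) (hG : G.Admissible p)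
    (hz : ∀ m, (z m).2 ∈ Set.Icc 0 E.Cmax) (hμ : ∀ t, OnBattery E.Cmax (μ t)) (hg : 0 < g)
    (hmar : MarginBound E g z μ) {Y : G.Profile} (hY : G.IsFiniteNash p E z Y) {m : Fin M}
    {y : G.Strategy} (hy : y ∈ G.strategySet p E (z m).1 m) :
    G.payoff p E (fun t => E.battery (z m) μ t) m y ≤
      G.payoff p E (fun t => E.battery (z m) μ t) m (Y m) + delta E p g z μ / 2 := by
  have hM : M ≠ 0 := by rintro rfl; exact m.elim0
  have hopt := hY.2 m y hy
  rw [utility_eq_payoff, utility_eq_payoff, Function.update_self, add_zero] at hopt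
  have hgap : (G.payoff p E (fun t => E.battery (z m) μ t) m y -
        G.payoff p E (fun t => E.battery (z m) (E.empFlow z) t) m y) -
      (G.payoff p E (fun t => E.battery (z m) μ t) m (Y m) -
        G.payoff p E (fun t => E.battery (z m) (E.empFlow z) t) m (Y m)) ≤
      delta E p g z μ / 2 := by
    have hK : 0 ≤ p.lamMax * (p.maxDeg * p.Pmax) / g ^ 2 := by
      have h1 := hp.lamMax_pos
      have h2 := hp.Pmax_pos
      positivity
    have hδ : delta E p g z μ / 2 = ∑ t : Fin E.T, p.lamMax * (p.maxDeg * p.Pmax) / g ^ 2 *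
        (E.battLip t * flowDist E.T (E.empFlow z) μ) := by
      rw [← Finset.mul_sum, ← Finset.sum_mul, Fin.sum_univ_eq_sum_range, delta, lipU]
      ring
    simp only [payoff]
    rw [hδ, ← Finset.sum_sub_distrib, ← Finset.sum_sub_distrib, ← Finset.sum_sub_distrib]
    refine Finset.sum_le_sum fun t _ => ?_
    refine (slotPayoff_gap_le hp hG hg (hmar m t).2 (hmar m t).1 (hy t) (hY.1 m t)).trans ?_
    refine mul_le_mul_of_nonneg_left ?_ hK
    rw [abs_sub_comm]
    exact EnergyModel.abs_battery_sub_battery_le hE (hz m)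
      (EnergyModel.onBattery_empFlow hM hz) hμ t.2.le
  linarith

theorem isApproxNash_of_isFiniteNash (hE : E.Valid) (hp : p.Valid) (hG : G.Admissible p)
    (hz : ∀ m, (z m).2 ∈ Set.Icc 0 E.Cmax) (hμ : ∀ t, OnBattery E.Cmax (μ t)) (hg : 0 < g)
    (hmar : MarginBound E g z μ) {Y : G.Profile} (hY : G.IsFiniteNash p E z Y) :
    G.IsApproxNash p E (delta E p g z μ) z μ Y := by
  refine ⟨hY.1, fun m y hy => ?_⟩
  rw [utility_eq_payoff, utility_eq_payoff, Function.update_self]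
  have h1 := payoff_le_of_isFiniteNash hE hp hG hz hμ hg hmar hY hy
  have h2 := delta_nonneg hE hp g z μ
  linarith

/-- Quadratic growth bounds `a / 2` times the squared distance by the payoff loss, which is at most
`δ / 2`; the halves cancel. -/
theorem rateDist_le (hE : E.Valid) (hp : p.Valid) (hG : G.Admissible p)
    (hz : ∀ m, (z m).2 ∈ Set.Icc 0 E.Cmax) (hμ : ∀ t, OnBattery E.Cmax (μ t)) (hg : 0 < g)
    (hmar : MarginBound E g z μ) {Y : G.Profile} (hY : G.IsFiniteNash p E z Y) {k : ℝ}
    {Ys : G.Profile}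
    (hYs : G.IsMFEStrategy p E k z μ Ys) {a : ℝ} (ha0 : 0 < a)
    (ha : G.PotentialStronglyConcave p E a z μ) (m : Fin M) :
    G.rateDist (Y m) (Ys m) ≤ Real.sqrt (delta E p g z μ / a) := by
  have h1 := rateDistSq_le_of_isMFEStrategy hp hG hYs ha (hY.1 m)
  have h2 := payoff_le_of_isFiniteNash hE hp hG hz hμ hg hmar hY (y := Ys m) fun t => (hYs m t).1
  have h3 : G.rateDistSq (Y m) (Ys m) = G.rateDistSq (Ys m) (Y m) := by
    unfold rateDistSq
    exact Finset.sum_congr rfl fun t _ => Finset.sum_congr rfl fun n _ => by ring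
  refine Real.sqrt_le_sqrt ?_
  rw [h3, le_div_iff₀ ha0]
  linarith

end Game

end Gap

/-! ### Convergence rates -/

theorem integral_sqrt_le {Ω : Type*} [MeasurableSpace Ω] {P : Measure Ω} [IsProbabilityMeasure P]
    {f : Ω → ℝ} (hf : Integrable f P) (h0 : ∀ ω, 0 ≤ f ω) :
    Integrable (fun ω => Real.sqrt (f ω)) P ∧
      ∫ ω, Real.sqrt (f ω) ∂P ≤ Real.sqrt (∫ ω, f ω ∂P) := by
  have hsq : ∀ ω, Real.sqrt (f ω) ^ 2 = f ω := fun ω => Real.sq_sqrt (h0 ω)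
  have hL : MemLp (fun ω => Real.sqrt (f ω)) 2 P := by
    refine (memLp_two_iff_integrable_sq
      (Real.continuous_sqrt.comp_aestronglyMeasurable hf.aestronglyMeasurable)).2 ?_
    simpa only [hsq] using hf
  refine ⟨hL.integrable one_le_two, ?_⟩
  have h := integral_abs_le_sqrt hL
  simpa only [hsq, abs_of_nonneg (Real.sqrt_nonneg _)] using h

section Rates

variable {Θ : Type*} [MeasurableSpace Θ] {Ω : Type*} [MeasurableSpace Ω] {P : Measure Ω}
  {E : EnergyModel Θ} {ρ : Measure (Θ × ℝ)} {Z : ℕ → Ω → Θ × ℝ} {μs : ℕ → Measure ℝ}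

theorem ae_initial_mem (hρ : ∀ᵐ z ∂ρ, z.2 ∈ Set.Icc 0 E.Cmax) (hZm : ∀ m, Measurable (Z m))
    (hZl : ∀ m, P.map (Z m) = ρ) : ∀ᵐ ω ∂P, ∀ m, (Z m ω).2 ∈ Set.Icc 0 E.Cmax :=
  ae_all_iff.2 fun m => ae_of_ae_map (hZm m).aemeasurable (by rwa [hZl m])

variable [IsProbabilityMeasure P] [IsProbabilityMeasure ρ]

/-- Because `μs` is deterministic, `E.battery (Z m ω) μs t` is one fixed function of the i.i.d.
pairs. The sampling bounds therefore apply in each slot, and the coupling transfers them to the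
interacting system. -/
theorem exists_flowDist_rate (hE : E.Valid) (hρ : ∀ᵐ z ∂ρ, z.2 ∈ Set.Icc 0 E.Cmax)
    (hZm : ∀ m, Measurable (Z m)) (hZi : iIndepFun Z P) (hZl : ∀ m, P.map (Z m) = ρ)
    (hμs : E.IsMeanFieldFlow ρ μs) :
    ∃ C : ℝ, 0 < C ∧
      (∀ M : ℕ, M ≠ 0 →
        Integrable (fun ω => flowDist E.T (E.empFlow fun m : Fin M => Z m ω) μs) P ∧
        ∫ ω, flowDist E.T (E.empFlow fun m : Fin M => Z m ω) μs ∂P ≤ C / Real.sqrt M) ∧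
      ∀ᵐ ω ∂P, Tendsto (fun M : ℕ => flowDist E.T (E.empFlow fun m : Fin M => Z m ω) μs)
        atTop (𝓝 0) := by
  have hR : 0 ≤ E.Cmax := hE.Cmin_nonneg.trans hE.Cmin_lt.le
  have hμ : ∀ t, OnBattery E.Cmax (μs t) := fun t => (hμs.onBattery_and_measurable hE hρ t).1
  have hb : ∀ t, Measurable fun z => E.battery z μs t := fun t =>
    (hμs.onBattery_and_measurable hE hρ t).2
  have hXm : ∀ t m, Measurable fun ω => E.battery (Z m ω) μs t := fun t m => (hb t).comp (hZm m)
  have hXi : ∀ t, iIndepFun (fun m ω => E.battery (Z m ω) μs t) P := fun t =>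
    hZi.comp (fun _ z => E.battery z μs t) fun _ => hb t
  have hXl : ∀ t m, P.map (fun ω => E.battery (Z m ω) μs t) = μs t := fun t m => by
    have h := Measure.map_map (μ := P) (hb t) (hZm m)
    rw [hZl m, ← hμs t] at h
    exact h.symm
  have hz := ae_initial_mem hρ hZm hZl
  obtain ⟨A, hA, hbound⟩ := EnergyModel.exists_flowDist_empFlow_le hE
  have hle : ∀ᵐ ω ∂P, ∀ M : ℕ, M ≠ 0 →
      flowDist E.T (E.empFlow fun m : Fin M => Z m ω) μs ≤ A * ∑ s ∈ Finset.range E.T,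
        W1 (empMeasure fun m : Fin M => E.battery (Z m ω) μs s) (μs s) := by
    filter_upwards [hz] with ω hω M hM using hbound M _ μs hM (fun m => hω m) hμ
  -- The added `1` only ensures positivity, as `A` or `E.T` may vanish.
  refine ⟨A * (E.T * E.Cmax) + 1, by positivity, fun M hM => ?_, ?_⟩
  · have hw := fun s => integral_W1_sample_le (hXm s) (hXi s) (hXl s) (hμ s) hR hM
    have hint : Integrable (fun ω => A * ∑ s ∈ Finset.range E.T,
        W1 (empMeasure fun m : Fin M => E.battery (Z m ω) μs s) (μs s)) P :=
      (integrable_finsetSum _ fun s _ => (hw s).1).const_mul A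
    have hleM : ∀ᵐ ω ∂P, flowDist E.T (E.empFlow fun m : Fin M => Z m ω) μs ≤
        A * ∑ s ∈ Finset.range E.T,
          W1 (empMeasure fun m : Fin M => E.battery (Z m ω) μs s) (μs s) := by
      filter_upwards [hle] with ω hω using hω M hM
    have hmeas : AEMeasurable
        (fun ω => flowDist E.T (E.empFlow fun m : Fin M => Z m ω) μs) P :=
      EnergyModel.aemeasurable_flowDist hE hM (measurable_pi_lambda _ fun m : Fin M => hZm m)
        (by filter_upwards [hz] with ω hω m using hω m) hμ
    have hI : Integrable (fun ω => flowDist E.T (E.empFlow fun m : Fin M => Z m ω) μs) P := by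
      refine hint.mono' hmeas.aestronglyMeasurable ?_
      filter_upwards [hleM] with ω hω
      rwa [Real.norm_eq_abs, abs_of_nonneg (flowDist_nonneg _ _ _)]
    refine ⟨hI, (integral_mono_ae hI hint hleM).trans ?_⟩
    rw [integral_const_mul, integral_finsetSum _ fun s _ => (hw s).1]
    calc A * ∑ s ∈ Finset.range E.T,
          ∫ ω, W1 (empMeasure fun m : Fin M => E.battery (Z m ω) μs s) (μs s) ∂P
        ≤ A * ∑ s ∈ Finset.range E.T, E.Cmax / Real.sqrt M :=
          mul_le_mul_of_nonneg_left (Finset.sum_le_sum fun s _ => (hw s).2) hA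
      _ = A * (E.T * E.Cmax) / Real.sqrt M := by
          rw [Finset.sum_const, Finset.card_range, nsmul_eq_mul]
          ring
      _ ≤ _ := by gcongr; linarith
  · have hw := ae_all_iff.2 fun s => ae_tendsto_W1_sample (hXm s) (hXi s) (hXl s) (hμ s)
    filter_upwards [hle, hw] with ω h1 h2
    have h3 : Tendsto (fun M : ℕ => A * ∑ s ∈ Finset.range E.T,
        W1 (empMeasure fun m : Fin M => E.battery (Z m ω) μs s) (μs s)) atTop (𝓝 0) := by
      simpa using (tendsto_finsetSum (Finset.range E.T) fun s _ => h2 s).const_mul A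
    refine squeeze_zero' (Eventually.of_forall fun _ => flowDist_nonneg _ _ _) ?_ h3
    filter_upwards [eventually_ne_atTop 0] with M hM using h1 M hM

end Rates

theorem sqrt_div_mul_sqrt_eq {a : ℝ} (ha : 0 < a) {b : ℝ} (hb : 0 ≤ b) (M : ℕ) :
    Real.sqrt (b / (a * Real.sqrt M)) = Real.sqrt (b / a) * (M : ℝ) ^ (-(1 / 4) : ℝ) := by
  have hM : (0 : ℝ) ≤ M := Nat.cast_nonneg M
  rw [← div_div, Real.sqrt_div (div_nonneg hb ha.le), Real.sqrt_eq_rpow (Real.sqrt M),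
    Real.sqrt_eq_rpow (M : ℝ), ← Real.rpow_mul hM, div_eq_mul_inv, ← Real.rpow_neg hM]
  norm_num

end SatGame

/-! ### Main theorem -/

theorem mainTheorem3 {Θ : Type*} [MeasurableSpace Θ] {Ω : Type*} [MeasurableSpace Ω]
    (P : Measure Ω) [IsProbabilityMeasure P]
    (E : SatGame.EnergyModel Θ) (hE : E.Valid)
    (ρ : Measure (Θ × ℝ)) [IsProbabilityMeasure ρ] (hρ : ∀ᵐ z ∂ρ, z.2 ∈ Set.Icc 0 E.Cmax)
    (Z : ℕ → Ω → Θ × ℝ) (hZm : ∀ m, Measurable (Z m)) (hZi : iIndepFun Z P)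
    (hZl : ∀ m, P.map (Z m) = ρ)
    (μs : ℕ → Measure ℝ) (hμs : E.IsMeanFieldFlow ρ μs) :
    ∃ Cμ : ℝ, 0 < Cμ ∧ ∀ (p : SatGame.Params) (_ : p.Valid) (g : ℝ) (_ : 0 < g)
      (_ : ∀ᵐ ω ∂P, ∀ M : ℕ, SatGame.MarginBound E g (fun m : Fin M => Z m ω) μs),
      -- the rate of `δ^M`
      (∀ M : ℕ, 1 ≤ M →
        Integrable (fun ω => SatGame.delta E p g (fun m : Fin M => Z m ω) μs) P ∧
        ∫ ω, SatGame.delta E p g (fun m : Fin M => Z m ω) μs ∂P ≤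
          2 * SatGame.lipU E p g * Cμ / Real.sqrt M) ∧
      (∀ᵐ ω ∂P, Tendsto (fun M : ℕ => SatGame.delta E p g (fun m : Fin M => Z m ω) μs)
        atTop (𝓝 0)) ∧
      -- the finite-player equilibrium is a `δ^M`-Nash equilibrium for the mean-field utility
      (∀ᵐ ω ∂P, ∀ M : ℕ, 1 ≤ M → ∀ G : SatGame.Game E.T M, G.Admissible p →
        ∀ Y : G.Profile, G.IsFiniteNash p E (fun m : Fin M => Z m ω) Y →
          G.IsApproxNash p E (SatGame.delta E p g (fun m : Fin M => Z m ω) μs)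
            (fun m : Fin M => Z m ω) μs Y) ∧
      -- the strategy gap
      (∀ᵐ ω ∂P, ∀ M : ℕ, 1 ≤ M → ∀ G : SatGame.Game E.T M, G.Admissible p →
        ∀ Y : G.Profile, G.IsFiniteNash p E (fun m : Fin M => Z m ω) Y →
        ∀ (k : ℝ) (Ys : G.Profile), G.IsMFEStrategy p E k (fun m : Fin M => Z m ω) μs Ys →
        ∀ a : ℝ, 0 < a → G.PotentialStronglyConcave p E a (fun m : Fin M => Z m ω) μs →
        ∀ m : Fin M, G.rateDist (Y m) (Ys m) ≤
          Real.sqrt (SatGame.delta E p g (fun m : Fin M => Z m ω) μs / a)) ∧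
      -- the rate of the strategy gap
      (∀ a : ℝ, 0 < a →
        (∀ M : ℕ, 1 ≤ M →
          Integrable (fun ω =>
            Real.sqrt (SatGame.delta E p g (fun m : Fin M => Z m ω) μs / a)) P ∧
          ∫ ω, Real.sqrt (SatGame.delta E p g (fun m : Fin M => Z m ω) μs / a) ∂P ≤
            Real.sqrt (2 * SatGame.lipU E p g * Cμ / (a * Real.sqrt M))) ∧
        (fun M : ℕ => ∫ ω,
            Real.sqrt (SatGame.delta E p g (fun m : Fin M => Z m ω) μs / a) ∂P)
          =O[atTop] fun M : ℕ => (M : ℝ) ^ (-(1 / 4) : ℝ)) ∧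
      -- strong concavity of the potential, with a modulus that does not depend on `M`
      (∃ a : ℝ, 0 < a ∧ ∀ᵐ ω ∂P, ∀ M : ℕ, 1 ≤ M → ∀ G : SatGame.Game E.T M,
        G.Admissible p → G.PotentialStronglyConcave p E a (fun m : Fin M => Z m ω) μs) := by
  have hμ : ∀ t, SatGame.OnBattery E.Cmax (μs t) := fun t =>
    (hμs.onBattery_and_measurable hE hρ t).1
  have hz := SatGame.ae_initial_mem hρ hZm hZl
  obtain ⟨C, hC, hmean, hlim⟩ := SatGame.exists_flowDist_rate hE hρ hZm hZi hZl hμs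
  refine ⟨C, hC, fun p hp g hg hmar => ?_⟩
  have hL := SatGame.lipU_nonneg hE hp g
  have hδ : ∀ M : ℕ, 1 ≤ M →
      Integrable (fun ω => SatGame.delta E p g (fun m : Fin M => Z m ω) μs) P ∧
      ∫ ω, SatGame.delta E p g (fun m : Fin M => Z m ω) μs ∂P ≤
        2 * SatGame.lipU E p g * C / Real.sqrt M := by
    intro M hM
    obtain ⟨h1, h2⟩ := hmean M (by omega)
    refine ⟨h1.const_mul _, ?_⟩
    simp only [SatGame.delta]
    rw [integral_const_mul, mul_div_assoc]
    exact mul_le_mul_of_nonneg_left h2 (by positivity)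
  have hsqrt : ∀ a : ℝ, 0 < a → ∀ M : ℕ, 1 ≤ M →
      Integrable (fun ω => Real.sqrt (SatGame.delta E p g (fun m : Fin M => Z m ω) μs / a)) P ∧
      ∫ ω, Real.sqrt (SatGame.delta E p g (fun m : Fin M => Z m ω) μs / a) ∂P ≤
        Real.sqrt (2 * SatGame.lipU E p g * C / (a * Real.sqrt M)) := by
    intro a ha M hM
    obtain ⟨h1, h2⟩ := hδ M hM
    obtain ⟨h3, h4⟩ := SatGame.integral_sqrt_le (h1.div_const a) fun ω =>
      div_nonneg (SatGame.delta_nonneg hE hp g _ μs) ha.le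
    refine ⟨h3, h4.trans (Real.sqrt_le_sqrt ?_)⟩
    rw [integral_div, mul_comm a, ← div_div]
    gcongr
  refine ⟨hδ, ?_, ?_, ?_, fun a ha => ⟨hsqrt a ha, ?_⟩,
    SatGame.Game.concavityModulus p E, SatGame.Game.concavityModulus_pos hp hE.De_pos, ?_⟩
  · filter_upwards [hlim] with ω hω
    simpa [SatGame.delta] using hω.const_mul (2 * SatGame.lipU E p g)
  -- Once the initial levels and the margins are under control the argument is deterministic, so one
  -- null set serves all games and equilibria.
  · filter_upwards [hz, hmar] with ω hω hm M _ G hG Y hY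
    exact SatGame.Game.isApproxNash_of_isFiniteNash hE hp hG (fun m => hω m) hμ hg (hm M) hY
  · filter_upwards [hz, hmar] with ω hω hm M _ G hG Y hY k Ys hYs a ha hconc m
    exact SatGame.Game.rateDist_le hE hp hG (fun m => hω m) hμ hg (hm M) hY hYs ha hconc m
  · refine IsBigO.of_bound (Real.sqrt (2 * SatGame.lipU E p g * C / a)) ?_
    filter_upwards [eventually_ge_atTop 1] with M hM
    rw [Real.norm_of_nonneg (integral_nonneg fun ω => Real.sqrt_nonneg _),
      Real.norm_of_nonneg (by positivity),
      ← SatGame.sqrt_div_mul_sqrt_eq ha (by positivity)]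
    exact (hsqrt a ha M hM).2
  · filter_upwards [hmar] with ω hm M _ G hG
    exact SatGame.Game.potentialStronglyConcave hp hG hE.De_pos fun m t =>
      hg.trans_le (hm M m t).2
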